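/- Let $d\ge 3$ be an integer and $q=2^d$, and let $G$ be the group $\mathrm{PSL}(2,q)$ as a transitive permutation group of degree $q(q-1)/2$ on a finite set $\Omega$. Let $\mathcal X=\mathrm{Inv}(G)$ be the large Hollmann scheme, i.e. the coherent configuration on $\Omega$ whose basis relations are the orbits of $G$ on $\Omega\times\Omega$, and let $\mathbf T_0=\{x\in\mathbb F_q:\mathrm{Tr}(x)=0\}$, where $\mathrm{Tr}$ is the trace of $\mathbb F_q$ over $\mathbb F_2$. For a relation $r\subseteq\Omega\times\Omega$ and $\alpha\in\Omega$ put $r^*=\{(\beta,\gamma):(\gamma,\beta)\in r\}$ and $\alpha r=\{\beta:(\alpha,\beta)\in r\}$. There is a bijection $x\mapsto s_x$ from $\mathbf T_0$ onto the set of basis relations of $\mathcal X$ such that $s_0=1_\Omega$ is the diagonal and, for all $x,y,z\in\mathbf T_0$ with $z\neq 0$, the intersection number $c_{s_x,s_y}^{s_z}=|\beta s_x\cap\gamma s_y^*|$, $(\beta,\gamma)\in s_z$, equals $1$ if and only if $\mathrm{Tr}(xz)=0$ and $x+y+z=0$. Moreover, let $x\mapsto s_x$ be any such bijection, let $\alpha\in\Omega$,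 and let $\mathcal X_\alpha$ be the one-point extension of $\mathcal X$, i.e. the smallest coherent configuration on $\Omega$ for which all basis relations of $\mathcal X$ and $\{(\alpha,\alpha)\}$ are relations (unions of basis relations). Then for all nonzero $x,y\in\mathbf T_0$ the sets $\Delta_x=\alpha s_x$ and $\Delta_y=\alpha s_y$ are fibers of $\mathcal X_\alpha$, and among the basis relations of $\mathcal X_\alpha$ contained in $\Delta_x\times\Delta_y$ there is a matching, i.e. a basis relation $r$ with $|\delta r|=1$ for all $\delta\in\Delta_x$ and $|\gamma r^*|=1$ for all $\gamma\in\Delta_y$. -/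

import Mathlib

namespace Hollmann

/-! ### Relations -/

section Relations

variable {Ω : Type*}

/-- The transposed relation `r*`. -/
def relStar (r : Set (Ω × Ω)) : Set (Ω × Ω) := {p | (p.2, p.1) ∈ r}

/-- The neighbourhood `α r = {β | (α, β) ∈ r}`. -/
def nbr (α : Ω) (r : Set (Ω × Ω)) : Set Ω := {β | (α, β) ∈ r}

/-- The diagonal `1_Δ` of `Δ × Δ`, as a relation on `Ω`. -/
def diagOn (Δ : Set Ω) : Set (Ω × Ω) := {p | p.1 = p.2 ∧ p.1 ∈ Δ}

/-- The set `S^∪` of all unions of members of `S`. -/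
def unions (S : Set (Set (Ω × Ω))) : Set (Set (Ω × Ω)) := {r | ∃ T ⊆ S, r = ⋃₀ T}

/-- The number `|α r ∩ β s*|`. -/
noncomputable def pathCount (r s : Set (Ω × Ω)) (α β : Ω) : ℕ :=
  (nbr α r ∩ nbr β (relStar s)).ncard

end Relations

/-! ### Rainbows and coherent configurations -/

/-- A rainbow: a partition `S` of `Ω × Ω` with `1_Ω ∈ S^∪` and `S* = S`. -/
structure Rainbow (Ω : Type*) where
  basis : Set (Set (Ω × Ω))
  isPartition : Setoid.IsPartition basis
  diag_mem : diagOn (Set.univ : Set Ω) ∈ unions basis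
  star_eq : relStar '' basis = basis

/-- A coherent configuration: a rainbow with well-defined intersection numbers. -/
structure CoherentConfiguration (Ω : Type*) extends Rainbow Ω where
  coherent : ∀ r ∈ basis, ∀ s ∈ basis, ∀ t ∈ basis, ∀ α β α' β' : Ω,
    (α, β) ∈ t → (α', β') ∈ t → pathCount r s α β = pathCount r s α' β'

namespace CoherentConfiguration

variable {Ω : Type*}

/-- The relations of `X`, i.e. the unions of basis relations. -/
def relations (X : CoherentConfiguration Ω) : Set (Set (Ω × Ω)) := unions X.basis

/-- `X ≤ Y` iff every relation of `X` is a relation of `Y`. -/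
instance : LE (CoherentConfiguration Ω) := ⟨fun X Y => X.relations ⊆ Y.relations⟩

/-- The fibers: the sets `Δ` for which `1_Δ` is a basis relation. -/
def fibers (X : CoherentConfiguration Ω) : Set (Set Ω) := {Δ | diagOn Δ ∈ X.basis}

/-- `S_{Δ,Γ}`: the basis relations contained in `Δ × Γ`. -/
def basisBetween (X : CoherentConfiguration Ω) (Δ Γ : Set Ω) : Set (Set (Ω × Ω)) :=
  {s | s ∈ X.basis ∧ s ⊆ Δ ×ˢ Γ}

/-- `n_s = n`: the relation `s` lies in `S_{Δ,Γ}` for some fibers `Δ`, `Γ`,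
and `|δ s| = n` for all `δ ∈ Δ`. -/
def HasValency (X : CoherentConfiguration Ω) (s : Set (Ω × Ω)) (n : ℕ) : Prop :=
  ∃ Δ ∈ X.fibers, ∃ Γ ∈ X.fibers, s ∈ X.basisBetween Δ Γ ∧ ∀ δ ∈ Δ, (nbr δ s).ncard = n

/-- A matching: a basis relation `s` with `n_s = n_{s*} = 1`. -/
def IsMatching (X : CoherentConfiguration Ω) (s : Set (Ω × Ω)) : Prop :=
  s ∈ X.basis ∧ X.HasValency s 1 ∧ X.HasValency (relStar s) 1

end CoherentConfiguration

/-! ### Coherent closure and point extensions -/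

section Closure

variable {Ω : Type*}

theorem relStar_relStar (r : Set (Ω × Ω)) : relStar (relStar r) = r := rfl

/-- A set of pairs is a union of cells of a partition iff it contains, with each point,
the whole cell of this point. -/
theorem mem_unions_iff {S : Set (Set (Ω × Ω))} (hS : Setoid.IsPartition S)
    {r : Set (Ω × Ω)} :
    r ∈ unions S ↔ ∀ t ∈ S, ∀ p ∈ t, ∀ q ∈ t, p ∈ r → q ∈ r := by
  constructor
  · rintro ⟨T, hT, rfl⟩ t ht p hp q hq ⟨u, hu, hpu⟩
    have : t = u := (hS.2 p).unique ⟨ht, hp⟩ ⟨hT hu, hpu⟩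
    exact ⟨u, hu, this ▸ hq⟩
  · intro h
    refine ⟨{t | t ∈ S ∧ t ⊆ r}, fun t ht => ht.1, ?_⟩
    ext p
    constructor
    · intro hp
      obtain ⟨t, ⟨ht, hpt⟩, -⟩ := hS.2 p
      exact ⟨t, ⟨ht, fun q hq => h t ht p hpt q hq hp⟩, hpt⟩
    · rintro ⟨t, ht, hpt⟩
      exact ht.2 hpt

/-- The relations common to all coherent configurations having all members of `T` as
relations. -/
def commonRelations (T : Set (Set (Ω × Ω))) : Set (Set (Ω × Ω)) :=
  {r | ∀ Y : CoherentConfiguration Ω, T ⊆ Y.relations → r ∈ Y.relations}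

/-- Two pairs are equivalent if no common relation separates them. -/
def closureSetoid (T : Set (Set (Ω × Ω))) : Setoid (Ω × Ω) where
  r p q := ∀ r ∈ commonRelations T, p ∈ r ↔ q ∈ r
  iseqv := ⟨fun _ _ _ => Iff.rfl, fun h r hr => (h r hr).symm,
    fun h h' r hr => (h r hr).trans (h' r hr)⟩

theorem class_mem_common {T : Set (Set (Ω × Ω))} {c : Set (Ω × Ω)}
    (hc : c ∈ (closureSetoid T).classes) : c ∈ commonRelations T := by
  obtain ⟨p, rfl⟩ := hc
  intro Y hY
  refine (mem_unions_iff Y.isPartition).2 fun t ht a ha b hb hap => ?_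
  intro r hr
  have h := (mem_unions_iff Y.isPartition).1 (hr Y hY)
  exact ⟨fun hbr => (hap r hr).1 (h t ht b hb a ha hbr),
    fun hpr => h t ht a ha b hb ((hap r hr).2 hpr)⟩

theorem relStar_mem_common {T : Set (Set (Ω × Ω))} {r : Set (Ω × Ω)}
    (hr : r ∈ commonRelations T) : relStar r ∈ commonRelations T := by
  intro Y hY
  have h := (mem_unions_iff Y.isPartition).1 (hr Y hY)
  refine (mem_unions_iff Y.isPartition).2 fun t ht a ha b hb har => ?_
  have ht' : relStar t ∈ Y.basis := by
    rw [← Y.star_eq]; exact ⟨t, ht, rfl⟩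
  exact h (relStar t) ht' (a.2, a.1) ha (b.2, b.1) hb har

theorem mem_unions_closure_iff {T : Set (Set (Ω × Ω))} {r : Set (Ω × Ω)} :
    r ∈ unions (closureSetoid T).classes ↔ r ∈ commonRelations T := by
  constructor
  · rintro ⟨U, hU, rfl⟩ Y hY
    refine (mem_unions_iff Y.isPartition).2 ?_
    rintro t ht a ha b hb ⟨u, hu, hau⟩
    exact ⟨u, hu, (mem_unions_iff Y.isPartition).1 (class_mem_common (hU hu) Y hY)
      t ht a ha b hb hau⟩
  · intro hr
    refine (mem_unions_iff (Setoid.isPartition_classes _)).2 ?_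
    rintro _ ⟨c, rfl⟩ a ha b hb har
    exact (hb r hr).2 ((ha r hr).1 har)

theorem pathCount_congr (Y : CoherentConfiguration Ω) [Finite Ω] {r s t : Set (Ω × Ω)}
    (hr : r ∈ Y.relations) (hs : s ∈ Y.relations) (ht : t ∈ Y.basis)
    {α β α' β' : Ω} (h : (α, β) ∈ t) (h' : (α', β') ∈ t) :
    pathCount r s α β = pathCount r s α' β' := by
  classical
  obtain ⟨R, hR, rfl⟩ := hr
  obtain ⟨U, hU, rfl⟩ := hs
  have key : ∀ a b : Ω, pathCount (⋃₀ R) (⋃₀ U) a b =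
      ∑ᶠ x : R × U, pathCount x.1.1 x.2.1 a b := by
    intro a b
    have hset : nbr a (⋃₀ R) ∩ nbr b (relStar (⋃₀ U)) =
        ⋃ x : R × U, (nbr a x.1.1 ∩ nbr b (relStar x.2.1)) := by
      ext c
      simp only [nbr, relStar, Set.mem_inter_iff, Set.mem_ofPred_eq, Set.mem_sUnion,
        Set.mem_iUnion]
      constructor
      · rintro ⟨⟨x, hx, hx'⟩, ⟨y, hy, hy'⟩⟩
        exact ⟨(⟨x, hx⟩, ⟨y, hy⟩), hx', hy'⟩
      · rintro ⟨⟨⟨x, hx⟩, ⟨y, hy⟩⟩, hx', hy'⟩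
        exact ⟨⟨x, hx, hx'⟩, ⟨y, hy, hy'⟩⟩
    unfold pathCount
    rw [hset]
    have hfin : Finite (R × U) := inferInstance
    have := Fintype.ofFinite (R × U)
    rw [finsum_eq_sum_of_fintype]
    have := Set.ncard_iUnion_of_finite
      (s := fun x : R × U => nbr a x.1.1 ∩ nbr b (relStar x.2.1))
      (fun x => Set.toFinite _) (by
        rintro ⟨⟨x, hx⟩, ⟨y, hy⟩⟩ ⟨⟨x', hx'⟩, ⟨y', hy'⟩⟩ hne
        refine Set.disjoint_left.2 ?_
        rintro c ⟨h1, h2⟩ ⟨h3, h4⟩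
        apply hne
        have e1 : x = x' := (Y.isPartition.2 (a, c)).unique ⟨hR hx, h1⟩ ⟨hR hx', h3⟩
        have e2 : y = y' := (Y.isPartition.2 (c, b)).unique ⟨hU hy, h2⟩ ⟨hU hy', h4⟩
        subst e1 e2
        rfl)
    rw [this, finsum_eq_sum_of_fintype]
  rw [key, key]
  exact finsum_congr fun x =>
    Y.coherent _ (hR x.1.2) _ (hU x.2.2) t ht _ _ _ _ h h'

/-- The coherent closure `WL(T)`: the smallest coherent configuration on `Ω` for which all
members of `T` are relations (see `coherentClosure_isLeast`). -/
def coherentClosure [Finite Ω] (T : Set (Set (Ω × Ω))) : CoherentConfiguration Ω where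
  basis := (closureSetoid T).classes
  isPartition := Setoid.isPartition_classes _
  diag_mem := mem_unions_closure_iff.2 fun Y _ => Y.diag_mem
  star_eq := by
    have h : ∀ c ∈ (closureSetoid T).classes, relStar c ∈ (closureSetoid T).classes := by
      rintro _ ⟨p, rfl⟩
      refine ⟨(p.2, p.1), ?_⟩
      ext a
      constructor
      · intro ha r hr
        exact ha (relStar r) (relStar_mem_common hr)
      · intro ha r hr
        exact ha (relStar r) (relStar_mem_common hr)
    ext c
    constructor
    · rintro ⟨e, he, rfl⟩
      exact h e he
    · intro hc
      exact ⟨relStar c, h c hc, rfl⟩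
  coherent := by
    intro r hr s hs t ht α β α' β' h h'
    have hmem : {p : Ω × Ω | pathCount r s p.1 p.2 = pathCount r s α β} ∈
        commonRelations T := by
      intro Y hY
      refine (mem_unions_iff Y.isPartition).2 fun u hu a ha b hb hab => ?_
      exact (pathCount_congr Y (class_mem_common hr Y hY) (class_mem_common hs Y hY)
        hu hb ha).trans hab
    obtain ⟨p, rfl⟩ := ht
    have : (α', β') ∈ {p : Ω × Ω | pathCount r s p.1 p.2 = pathCount r s α β} :=
      (h' _ hmem).2 ((h _ hmem).1 rfl)
    exact this.symm

theorem coherentClosure_isLeast [Finite Ω] (T : Set (Set (Ω × Ω))) :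
    IsLeast {Y : CoherentConfiguration Ω | T ⊆ Y.relations} (coherentClosure T) :=
  ⟨fun _ ht => mem_unions_closure_iff.2 fun _ hY => hY ht,
    fun Y hY _ hr => mem_unions_closure_iff.1 hr Y hY⟩

/-- The one-point extension `X_α = WL(S(X) ∪ {1_α})`. -/
def CoherentConfiguration.pointExtension [Finite Ω] (X : CoherentConfiguration Ω) (α : Ω) :
    CoherentConfiguration Ω :=
  coherentClosure (X.basis ∪ {diagOn {α}})

end Closure

/-! ### The coherent configuration of a permutation group -/

section Inv

variable {Ω : Type*}

/-- The coherent configuration `Inv(G)` of a permutation group `G` on `Ω`: its basis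
relations are the orbits of `G` on `Ω × Ω`. -/
def inv (G : Subgroup (Equiv.Perm Ω)) : CoherentConfiguration Ω where
  basis := Set.range fun p : Ω × Ω => MulAction.orbit G p
  isPartition := by
    refine ⟨?_, fun a => ⟨MulAction.orbit G a, ⟨⟨a, rfl⟩, MulAction.mem_orbit_self a⟩, ?_⟩⟩
    · rintro ⟨p, hp⟩
      exact (MulAction.nonempty_orbit p).ne_empty hp
    · rintro _ ⟨⟨p, rfl⟩, hp⟩
      exact (MulAction.orbit_eq_iff.2 hp).symm
  diag_mem := by
    refine ⟨{t | ∃ α : Ω, t = MulAction.orbit G (α, α)}, ?_, ?_⟩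
    · rintro _ ⟨α, rfl⟩
      exact ⟨_, rfl⟩
    · ext ⟨a, b⟩
      constructor
      · rintro ⟨h, -⟩
        simp only at h
        subst h
        exact ⟨_, ⟨a, rfl⟩, MulAction.mem_orbit_self _⟩
      · rintro ⟨_, ⟨α, rfl⟩, g, hg⟩
        have h1 : g • α = a := congrArg Prod.fst hg
        have h2 : g • α = b := congrArg Prod.snd hg
        exact ⟨h1.symm.trans h2, Set.mem_univ _⟩
  star_eq := by
    have h : ∀ p : Ω × Ω, relStar (MulAction.orbit G p) = MulAction.orbit G (p.2, p.1) := by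
      rintro ⟨a, b⟩
      ext ⟨c, e⟩
      constructor
      · rintro ⟨g, hg⟩
        exact ⟨g, Prod.ext (congrArg Prod.snd hg) (congrArg Prod.fst hg)⟩
      · rintro ⟨g, hg⟩
        exact ⟨g, Prod.ext (congrArg Prod.snd hg) (congrArg Prod.fst hg)⟩
    ext c
    constructor
    · rintro ⟨_, ⟨p, rfl⟩, rfl⟩
      exact ⟨_, (h p).symm⟩
    · rintro ⟨p, rfl⟩
      exact ⟨_, ⟨(p.2, p.1), rfl⟩, h _⟩
  coherent := by
    have hinv : ∀ (p : Ω × Ω) (g : G) (a b : Ω),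
        (g • a, g • b) ∈ MulAction.orbit G p ↔ (a, b) ∈ MulAction.orbit G p := by
      intro p g a b
      constructor
      · intro h
        have h' := MulAction.mem_orbit_of_mem_orbit g⁻¹ h
        rwa [Prod.smul_mk, inv_smul_smul, inv_smul_smul] at h'
      · intro h
        exact MulAction.mem_orbit_of_mem_orbit g h
    rintro _ ⟨r, rfl⟩ _ ⟨s, rfl⟩ _ ⟨t, rfl⟩ α β α' β' h h'
    have hm : (α', β') ∈ MulAction.orbit G (α, β) := by
      rw [MulAction.orbit_eq_iff.2 h]; exact h'
    obtain ⟨g, hg⟩ := hm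
    have h1 : g • α = α' := congrArg Prod.fst hg
    have h2 : g • β = β' := congrArg Prod.snd hg
    subst h1 h2
    refine Set.ncard_congr (fun c _ => g • c) ?_ ?_ ?_
    · rintro c ⟨hc, hc'⟩
      exact ⟨(hinv r g α c).2 hc, (hinv s g c β).2 hc'⟩
    · intro a b _ _ hab
      exact MulAction.injective g hab
    · rintro c ⟨hc, hc'⟩
      refine ⟨g⁻¹ • c, ⟨?_, ?_⟩, smul_inv_smul g c⟩
      · refine (hinv r g α (g⁻¹ • c)).1 ?_
        rw [smul_inv_smul]; exact hc
      · refine (hinv s g (g⁻¹ • c) β).1 ?_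
        rw [smul_inv_smul]; exact hc'

end Inv

/-! ### Large Hollmann schemes -/

/-- `T₀`: the elements of trace zero over the prime field `𝔽₂`. -/
noncomputable def traceZero (F : Type*) [Field F] [Algebra (ZMod 2) F] :
    Submodule (ZMod 2) F :=
  LinearMap.ker (Algebra.trace (ZMod 2) F)

/-- `G` is the group `PSL(2, F)` as a transitive permutation group of degree `q(q-1)/2`,
where `q = |F|`. -/
structure IsHollmannGroup (F : Type*) [Field F] {Ω : Type*}
    (G : Subgroup (Equiv.Perm Ω)) : Prop where
  iso : Nonempty (G ≃* Matrix.ProjectiveSpecialLinearGroup (Fin 2) F)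
  transitive : MulAction.IsPretransitive G Ω
  degree : Nat.card Ω = Nat.card F * (Nat.card F - 1) / 2

/-- `x ↦ s_x` is a bijection from `T₀` onto the basis relations of `X` such that `s_0` is the
diagonal and, for all `x`, `y` and all `z ≠ 0`, the intersection number of `s_x`, `s_y` with
respect to `s_z` equals `1` iff `Tr(xz) = 0` and `x + y + z = 0`. -/
structure IsHollmannLabelling {F : Type*} [Field F] [Algebra (ZMod 2) F] {Ω : Type*}
    (X : CoherentConfiguration Ω) (s : traceZero F → Set (Ω × Ω)) : Prop where
  bijOn : Set.BijOn s Set.univ X.basis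
  zero : s 0 = Set.diagonal Ω
  intersection : ∀ x y z : traceZero F, z ≠ 0 → ∀ β γ : Ω, (β, γ) ∈ s z →
    (pathCount (s x) (s y) β γ = 1 ↔
      Algebra.trace (ZMod 2) F ((x : F) * (z : F)) = 0 ∧ x + y + z = 0)

end Hollmann

namespace Hollmann

open Matrix

/-! ### The trace of a finite field of characteristic two -/

section Trace

variable {F : Type*} [Field F] [Algebra (ZMod 2) F]

theorem charP_two (F : Type*) [Field F] [Algebra (ZMod 2) F] : CharP F 2 :=
  charP_of_injective_algebraMap (algebraMap (ZMod 2) F).injective 2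

theorem two_eq_zero_of_algebra (F : Type*) [Field F] [Algebra (ZMod 2) F] : (2 : F) = 0 := by
  have := charP_two F
  exact CharTwo.two_eq_zero

variable [Finite F]

theorem exists_sq_eq (a : F) : ∃ k : F, k ^ 2 = a := by
  have := charP_two F
  have h := FiniteField.isSquare_of_char_two (ringChar.eq_iff.2 this) a
  obtain ⟨k, hk⟩ := h
  exact ⟨k, by rw [hk, sq]⟩

theorem trace_sq (a : F) : Algebra.trace (ZMod 2) F (a ^ 2) = Algebra.trace (ZMod 2) F a := by
  have := charP_two F
  have h := Algebra.trace_eq_of_algEquiv (FiniteField.frobeniusAlgEquiv (ZMod 2) F 2) a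
  simpa [FiniteField.frobeniusAlgEquiv] using h

theorem trace_add_sq (a : F) : Algebra.trace (ZMod 2) F (a + a ^ 2) = 0 := by
  rw [map_add, trace_sq]
  exact CharTwo.add_self_eq_zero _

/-- Half of the elements have trace zero. -/
theorem two_mul_card_traceZero : 2 * Nat.card (traceZero F) = Nat.card F := by
  have h := (LinearMap.ker (Algebra.trace (ZMod 2) F)).card_eq_card_quotient_mul_card
  have e := (Algebra.trace (ZMod 2) F).quotKerEquivOfSurjective
    (Algebra.trace_surjective (ZMod 2) F)
  rw [Nat.card_congr e.toEquiv, Nat.card_zmod] at h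
  rw [h, traceZero, mul_comm]

/-- The additive form of Hilbert 90 for `a ↦ a ^ 2`. -/
theorem exists_add_sq_eq {t : F} (ht : Algebra.trace (ZMod 2) F t = 0) :
    ∃ k : F, k + k ^ 2 = t := by
  have h2 := two_eq_zero_of_algebra F
  let f : F →+ F :=
    { toFun := fun k => k + k ^ 2
      map_zero' := by simp
      map_add' := fun a b => by linear_combination a * b * h2 }
  have hker : Nat.card f.ker ≤ 2 := by
    have : (f.ker : Set F) ⊆ {0, 1} := by
      intro k hk
      have hk' : k * (1 + k) = 0 := by
        have : k + k ^ 2 = 0 := hk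
        linear_combination this
      rcases mul_eq_zero.1 hk' with h | h
      · exact Or.inl h
      · right
        show k = 1
        linear_combination h - h2
    calc Nat.card f.ker = (f.ker : Set F).ncard := Nat.card_coe_set_eq _
      _ ≤ ({0, 1} : Set F).ncard := Set.ncard_le_ncard this (Set.toFinite _)
      _ ≤ 2 := Set.ncard_insert_le _ _ |>.trans (by simp)
  have hcard : Nat.card f.range * Nat.card f.ker = Nat.card F := by
    rw [← AddSubgroup.index_ker, mul_comm, AddSubgroup.card_mul_index]
  have hle : (f.range : Set F) ⊆ (traceZero F : Set F) := by
    rintro _ ⟨k, rfl⟩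
    exact trace_add_sq k
  have hT := two_mul_card_traceZero (F := F)
  have heq : (f.range : Set F) = (traceZero F : Set F) := by
    refine Set.eq_of_subset_of_ncard_le hle ?_ (Set.toFinite _)
    have h1 : (traceZero F : Set F).ncard = Nat.card (traceZero F) := (Nat.card_coe_set_eq _).symm
    have h3 : (f.range : Set F).ncard = Nat.card f.range := (Nat.card_coe_set_eq _).symm
    rw [h1, h3]
    nlinarith
  have : t ∈ (f.range : Set F) := by
    rw [heq]
    exact ht
  exact this

theorem zmod_two_eq_one {a : ZMod 2} (h : a ≠ 0) : a = 1 := by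
  revert a
  decide

end Trace

/-! ### Elliptic quadratic forms on the plane -/

section Forms

variable {F : Type*} [Field F]

/-- The standard symplectic form on the plane, written without signs. -/
def polar (v w : F × F) : F := v.1 * w.2 + v.2 * w.1

/-- The quadratic form with polar form `polar` and values `p.1`, `p.2` at the standard basis. -/
def form (p v : F × F) : F := p.1 * v.1 ^ 2 + v.1 * v.2 + p.2 * v.2 ^ 2

/-- The quadratic form `form p + (polar v ·) ^ 2`. -/
def shift (p v : F × F) : F × F := (p.1 + v.2 ^ 2, p.2 + v.1 ^ 2)

theorem form_injective {p p' : F × F} (h : ∀ v, form p v = form p' v) : p = p' := by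
  have h1 := h (1, 0)
  have h2 := h (0, 1)
  simp only [form] at h1 h2
  ext
  · linear_combination h1
  · linear_combination h2

theorem form_smul (p : F × F) (k : F) (v : F × F) : form p (k • v) = k ^ 2 * form p v := by
  simp only [form, Prod.smul_fst, Prod.smul_snd, smul_eq_mul]
  ring

theorem polar_smul_left (k : F) (v w : F × F) : polar (k • v) w = k * polar v w := by
  simp only [polar, Prod.smul_fst, Prod.smul_snd, smul_eq_mul]
  ring

theorem polar_add_left (u v w : F × F) : polar (u + v) w = polar u w + polar v w := by
  simp only [polar, Prod.fst_add, Prod.snd_add]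
  ring

theorem polar_comm (v w : F × F) : polar v w = polar w v := by
  simp only [polar]
  ring

theorem polar_smul_right (k : F) (v w : F × F) : polar v (k • w) = k * polar v w := by
  rw [polar_comm, polar_smul_left, polar_comm]

theorem polar_add_right (u v w : F × F) : polar u (v + w) = polar u v + polar u w := by
  rw [polar_comm, polar_add_left, polar_comm v, polar_comm w]

theorem shift_zero (p : F × F) : shift p 0 = p := by
  simp [shift]

theorem exists_polar_eq_one {v : F × F} (hv : v ≠ 0) : ∃ w, polar v w = 1 := by
  by_cases h1 : v.1 = 0
  · have hv2 : v.2 ≠ 0 := fun h2 => hv (Prod.ext h1 h2)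
    exact ⟨(v.2⁻¹, 0), by simp [polar, hv2]⟩
  · exact ⟨(0, v.1⁻¹), by simp [polar, h1]⟩

theorem ne_zero_of_form_eq {p v : F × F} {x : F} (h : form p v = x) (hx : x ≠ 0) : v ≠ 0 := by
  rintro rfl
  exact hx (by rw [← h]; simp [form])

variable [Algebra (ZMod 2) F]

theorem polar_self (v : F × F) : polar v v = 0 := by
  simp only [polar]
  linear_combination v.1 * v.2 * two_eq_zero_of_algebra F

theorem form_add (p v w : F × F) : form p (v + w) = form p v + form p w + polar v w := by
  simp only [form, polar, Prod.fst_add, Prod.snd_add]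
  linear_combination (p.1 * v.1 * w.1 + p.2 * v.2 * w.2) * two_eq_zero_of_algebra F

theorem add_self_plane (v : F × F) : v + v = 0 := by
  have := charP_two F
  ext <;> simp [CharTwo.add_self_eq_zero]

theorem form_shift (p v u : F × F) : form (shift p v) u = form p u + polar v u ^ 2 := by
  simp only [form, polar, shift]
  linear_combination (-v.1 * u.2 * v.2 * u.1) * two_eq_zero_of_algebra F

theorem shift_shift (p v w : F × F) : shift (shift p v) w = shift p (v + w) := by
  refine form_injective fun u => ?_
  simp only [form_shift, polar_add_left]
  linear_combination (-polar v u * polar w u) * two_eq_zero_of_algebra F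

theorem sq_injective_of_algebra {a b : F} (h : a ^ 2 = b ^ 2) : a = b := by
  have := charP_two F
  exact CharTwo.sq_injective h

theorem shift_injective {p v w : F × F} (h : shift p v = shift p w) : v = w := by
  simp only [shift, Prod.mk.injEq, add_right_inj] at h
  exact Prod.ext (sq_injective_of_algebra h.2) (sq_injective_of_algebra h.1)

theorem exists_smul_eq_of_polar_eq_zero {v w : F × F} (hw : w ≠ 0) (h : polar v w = 0) :
    ∃ k : F, v = k • w := by
  have h2 := two_eq_zero_of_algebra F
  simp only [polar] at h
  by_cases h1 : w.1 = 0
  · have hw2 : w.2 ≠ 0 := fun h2 => hw (Prod.ext h1 h2)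
    refine ⟨v.2 / w.2, Prod.ext ?_ ?_⟩
    · have : v.1 * w.2 = 0 := by rw [h1] at h; linear_combination h
      simp [h1, (mul_eq_zero.1 this).resolve_right hw2]
    · simp [hw2]
  · refine ⟨v.1 / w.1, Prod.ext ?_ ?_⟩
    · simp [h1]
    · simp only [Prod.smul_snd, smul_eq_mul]
      field_simp
      linear_combination h - v.1 * w.2 * h2

/-- Vectors of equal value on a common line coincide. -/
theorem eq_of_polar_eq_zero {p v w : F × F} (hw : form p w ≠ 0) (h : polar v w = 0)
    (h' : form p v = form p w) : v = w := by
  have hw0 : w ≠ 0 := by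
    rintro rfl
    exact hw (by simp [form])
  obtain ⟨k, rfl⟩ := exists_smul_eq_of_polar_eq_zero hw0 h
  rw [form_smul] at h'
  have hk : k ^ 2 = 1 ^ 2 := mul_right_cancel₀ hw (by rw [h']; ring)
  rw [sq_injective_of_algebra hk, one_smul]

variable [Finite F]

theorem exists_shift_eq (p p' : F × F) : ∃ v, p' = shift p v := by
  obtain ⟨a, ha⟩ := exists_sq_eq (p'.2 - p.2)
  obtain ⟨b, hb⟩ := exists_sq_eq (p'.1 - p.1)
  exact ⟨(a, b), by ext <;> simp [shift, ha, hb]⟩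

/-- The form `form p` is elliptic. -/
def IsElliptic (p : F × F) : Prop := Algebra.trace (ZMod 2) F (p.1 * p.2) = 1

/-- Invariance of the Arf invariant. -/
theorem IsElliptic.trace_mul {p v w : F × F} (hp : IsElliptic p) (h : polar v w = 1) :
    Algebra.trace (ZMod 2) F (form p v * form p w) = 1 := by
  have h2 := two_eq_zero_of_algebra F
  have key : form p v * form p w = p.1 * p.2 +
      ((p.1 * v.1 * w.1 + p.2 * v.2 * w.2 + v.2 * w.1) +
        (p.1 * v.1 * w.1 + p.2 * v.2 * w.2 + v.2 * w.1) ^ 2) := by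
    simp only [form, polar] at h ⊢
    grind
  rw [key, map_add, trace_add_sq, hp, add_zero]

theorem IsElliptic.eq_zero {p v : F × F} (hp : IsElliptic p) (h : form p v = 0) : v = 0 := by
  by_contra hv
  obtain ⟨w, hw⟩ := exists_polar_eq_one hv
  have := hp.trace_mul hw
  simp [h] at this

theorem isElliptic_shift_iff {p v : F × F} (hp : IsElliptic p) :
    IsElliptic (shift p v) ↔ Algebra.trace (ZMod 2) F (form p v) = 0 := by
  have key : (shift p v).1 * (shift p v).2 =
      p.1 * p.2 + (form p v + ((v.1 * v.2) + (v.1 * v.2) ^ 2)) := by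
    simp only [shift, form]
    linear_combination (-v.1 * v.2) * two_eq_zero_of_algebra F
  rw [IsElliptic, key, map_add, map_add _ (form p v), trace_add_sq, hp]
  simp

/-- A vector can be completed to a symplectic basis with a prescribed second value. -/
theorem IsElliptic.exists_basis {p v : F × F} (hp : IsElliptic p) (hv : form p v ≠ 0) {c : F}
    (hc : Algebra.trace (ZMod 2) F (form p v * c) = 1) :
    ∃ w, polar v w = 1 ∧ form p w = c := by
  have h2 := two_eq_zero_of_algebra F
  obtain ⟨w, hw⟩ := exists_polar_eq_one (ne_zero_of_form_eq rfl hv)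
  obtain ⟨k, hk⟩ := exists_add_sq_eq (t := form p v * c + form p v * form p w) (by
    rw [map_add, hc, hp.trace_mul hw]; decide)
  refine ⟨w + (k / form p v) • v, ?_, ?_⟩
  · rw [polar_add_right, polar_smul_right, polar_self, hw]
    ring
  · rw [form_add, form_smul, polar_smul_right, polar_comm, hw]
    field_simp
    linear_combination hk + form p v * form p w * h2

theorem exists_form_eq {p : F × F} (hp : IsElliptic p) (x : F) : ∃ v, form p v = x := by
  have h1 : p.1 ≠ 0 := by
    intro h
    simp [IsElliptic, h] at hp
  obtain ⟨k, hk⟩ := exists_sq_eq (x / p.1)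
  exact ⟨(k, 0), by simp [form, hk, mul_div_cancel₀ _ h1]⟩

end Forms

/-! ### The action of `SL(2, F)` on vectors and forms -/

section Action

variable {F : Type*} [Field F]

/-- The natural action of `SL(2, F)` on the plane. -/
def planeAct (m : SpecialLinearGroup (Fin 2) F) (v : F × F) : F × F :=
  (m.1 0 0 * v.1 + m.1 0 1 * v.2, m.1 1 0 * v.1 + m.1 1 1 * v.2)

theorem planeAct_mul (m n : SpecialLinearGroup (Fin 2) F) (v : F × F) :
    planeAct (m * n) v = planeAct m (planeAct n v) := by
  have h : ∀ i j, (m * n).1 i j = m.1 i 0 * n.1 0 j + m.1 i 1 * n.1 1 j := fun i j => by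
    change (m.1 * n.1) i j = _
    rw [mul_apply, Fin.sum_univ_two]
  simp only [planeAct, h]
  ext <;> simp only <;> ring

theorem planeAct_one (v : F × F) : planeAct (1 : SpecialLinearGroup (Fin 2) F) v = v := by
  simp [planeAct]

theorem planeAct_inv_planeAct (m : SpecialLinearGroup (Fin 2) F) (v : F × F) :
    planeAct m⁻¹ (planeAct m v) = v := by
  rw [← planeAct_mul, inv_mul_cancel, planeAct_one]

theorem planeAct_planeAct_inv (m : SpecialLinearGroup (Fin 2) F) (v : F × F) :
    planeAct m (planeAct m⁻¹ v) = v := by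
  rw [← planeAct_mul, mul_inv_cancel, planeAct_one]

theorem planeAct_add (m : SpecialLinearGroup (Fin 2) F) (v w : F × F) :
    planeAct m (v + w) = planeAct m v + planeAct m w := by
  simp only [planeAct]
  ext <;> simp only [Prod.fst_add, Prod.snd_add] <;> ring

theorem planeAct_smul (m : SpecialLinearGroup (Fin 2) F) (k : F) (v : F × F) :
    planeAct m (k • v) = k • planeAct m v := by
  simp only [planeAct]
  ext <;> simp only [Prod.smul_fst, Prod.smul_snd, smul_eq_mul] <;> ring

/-- The form `form p ∘ m`. -/
def pullback (p : F × F) (m : SpecialLinearGroup (Fin 2) F) : F × F :=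
  (form p (planeAct m (1, 0)), form p (planeAct m (0, 1)))

theorem polar_nondegenerate {v w : F × F} (h : ∀ u, polar v u = polar w u) : v = w := by
  have h1 := h (1, 0)
  have h2 := h (0, 1)
  simp only [polar] at h1 h2
  ext
  · linear_combination h2
  · linear_combination h1

variable [Algebra (ZMod 2) F]

theorem planeAct_det (m : SpecialLinearGroup (Fin 2) F) :
    m.1 0 0 * m.1 1 1 + m.1 0 1 * m.1 1 0 = 1 := by
  have h := m.2
  rw [det_fin_two] at h
  linear_combination h + m.1 0 1 * m.1 1 0 * two_eq_zero_of_algebra F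

theorem polar_planeAct (m : SpecialLinearGroup (Fin 2) F) (v w : F × F) :
    polar (planeAct m v) (planeAct m w) = polar v w := by
  simp only [planeAct, polar]
  linear_combination (v.1 * w.2 + v.2 * w.1) * planeAct_det m +
    (m.1 0 0 * m.1 1 0 * v.1 * w.1 + m.1 0 1 * m.1 1 1 * v.2 * w.2) * two_eq_zero_of_algebra F

theorem form_pullback (p : F × F) (m : SpecialLinearGroup (Fin 2) F) (v : F × F) :
    form (pullback p m) v = form p (planeAct m v) := by
  have hv : v = v.1 • ((1 : F), (0 : F)) + v.2 • ((0 : F), (1 : F)) := by ext <;> simp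
  conv_rhs => rw [hv]
  rw [planeAct_add, form_add, planeAct_smul, planeAct_smul, form_smul, form_smul,
    polar_smul_left, polar_smul_right, polar_planeAct]
  simp only [form, pullback, polar]
  ring

theorem pullback_mul (p : F × F) (m n : SpecialLinearGroup (Fin 2) F) :
    pullback p (m * n) = pullback (pullback p m) n :=
  form_injective fun v => by simp only [form_pullback, planeAct_mul]

theorem form_eq_of_pullback_eq {p : F × F} {n : SpecialLinearGroup (Fin 2) F}
    (h : pullback p n = p) (v : F × F) : form p (planeAct n v) = form p v := by
  rw [← form_pullback, h]

/-- Vectors with product `1` are the columns of an element of `SL(2, F)`. -/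
theorem exists_planeAct_eq {v w : F × F} (h : polar v w = 1) :
    ∃ m : SpecialLinearGroup (Fin 2) F, planeAct m (1, 0) = v ∧ planeAct m (0, 1) = w := by
  refine ⟨⟨!![v.1, w.1; v.2, w.2], ?_⟩, ?_, ?_⟩
  · rw [det_fin_two_of]
    simp only [polar] at h
    linear_combination h - w.1 * v.2 * two_eq_zero_of_algebra F
  · simp [planeAct]
  · simp [planeAct]

theorem eq_of_polar_eq_one {v w : F × F} (h : polar v w = 1) (u : F × F) :
    u = polar u w • v + polar u v • w := by
  have h2 := two_eq_zero_of_algebra F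
  simp only [polar] at h ⊢
  ext
  · simp only [Prod.fst_add, Prod.smul_fst, smul_eq_mul]
    linear_combination (-u.1) * h - u.2 * v.1 * w.1 * h2
  · simp only [Prod.snd_add, Prod.smul_snd, smul_eq_mul]
    linear_combination (-u.2) * h - u.1 * v.2 * w.2 * h2

theorem ext_of_polar_eq_one {v w : F × F} (h : polar v w = 1)
    {m n : SpecialLinearGroup (Fin 2) F} (hv : planeAct m v = planeAct n v)
    (hw : planeAct m w = planeAct n w) : m = n := by
  have key : ∀ u, planeAct m u = planeAct n u := fun u => by
    rw [eq_of_polar_eq_one h u, planeAct_add, planeAct_add, planeAct_smul, planeAct_smul,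
      planeAct_smul, planeAct_smul, hv, hw]
  have h1 := key (1, 0)
  have h2 := key (0, 1)
  simp only [planeAct, Prod.mk.injEq, mul_one, mul_zero, add_zero, zero_add] at h1 h2
  ext i j
  fin_cases i <;> fin_cases j <;> simp_all

/-- An element of odd order fixing a nonzero vector is trivial. -/
theorem eq_one_of_planeAct_eq_self {n : SpecialLinearGroup (Fin 2) F} {k : ℕ} (hk : Odd k)
    (hn : n ^ k = 1) {v : F × F} (hv : v ≠ 0) (h : planeAct n v = v) : n = 1 := by
  obtain ⟨w, hw⟩ := exists_polar_eq_one hv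
  have h0 : polar (planeAct n w + w) v = 0 := by
    have h1 := polar_planeAct n w v
    rw [h] at h1
    rw [polar_add_left, h1, polar_comm, hw]
    linear_combination two_eq_zero_of_algebra F
  obtain ⟨a, ha⟩ := exists_smul_eq_of_polar_eq_zero hv h0
  have hnw : planeAct n w = a • v + w := by
    rw [← ha, add_assoc, add_self_plane, add_zero]
  have hsq : n ^ 2 = 1 := by
    refine ext_of_polar_eq_one hw ?_ ?_
    · rw [sq, planeAct_mul, h, h, planeAct_one]
    · rw [sq, planeAct_mul, hnw, planeAct_add, planeAct_smul, h, hnw, planeAct_one, ← add_assoc,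
        add_self_plane, zero_add]
  obtain ⟨j, rfl⟩ := hk
  rwa [pow_succ, pow_mul, hsq, one_pow, one_mul] at hn

variable [Finite F]

/-- The elliptic forms are a single orbit; moreover a nonzero vector can be carried along. -/
theorem IsElliptic.exists_pullback {p p' v v' : F × F} (hp : IsElliptic p) (hp' : IsElliptic p')
    (hv : form p v ≠ 0) (h : form p' v' = form p v) :
    ∃ m : SpecialLinearGroup (Fin 2) F, pullback p' m = p ∧ planeAct m v = v' := by
  obtain ⟨w, hw⟩ := exists_polar_eq_one (ne_zero_of_form_eq rfl hv)
  obtain ⟨w', hw', hc⟩ := hp'.exists_basis (v := v') (h ▸ hv) (c := form p w)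
    (h ▸ hp.trace_mul hw)
  obtain ⟨m, hm1, hm2⟩ := exists_planeAct_eq hw
  obtain ⟨n, hn1, hn2⟩ := exists_planeAct_eq hw'
  have h1 : planeAct m⁻¹ v = (1, 0) := by rw [← hm1, planeAct_inv_planeAct]
  have h3 : planeAct m⁻¹ w = (0, 1) := by rw [← hm2, planeAct_inv_planeAct]
  have hv' : planeAct (n * m⁻¹) v = v' := by rw [planeAct_mul, h1, hn1]
  have hw'' : planeAct (n * m⁻¹) w = w' := by rw [planeAct_mul, h3, hn2]
  refine ⟨n * m⁻¹, form_injective fun u => ?_, hv'⟩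
  rw [form_pullback, eq_of_polar_eq_one hw u, planeAct_add, planeAct_smul, planeAct_smul, hv',
    hw'', form_add, form_add, form_smul, form_smul, form_smul, form_smul, h, hc,
    polar_smul_left, polar_smul_right, polar_smul_left, polar_smul_right, hw, hw']

theorem IsElliptic.pullback {p : F × F} (hp : IsElliptic p)
    (m : SpecialLinearGroup (Fin 2) F) : IsElliptic (pullback p m) := by
  refine hp.trace_mul (v := planeAct m (1, 0)) (w := planeAct m (0, 1)) ?_
  rw [polar_planeAct]
  simp [polar]

end Action

/-! ### Subgroups of order `2 (q + 1)` -/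

section Subgroups

variable {F : Type*} [Field F] [Algebra (ZMod 2) F] [Finite F]

/-- A group of order `q + 1` fixes a form. -/
theorem exists_pullback_eq_of_card (N : Subgroup (SpecialLinearGroup (Fin 2) F))
    (hN : Nat.card N = Nat.card F + 1) : ∃ p : F × F, ∀ n ∈ N, pullback p n = p := by
  have := Fintype.ofFinite N
  have hone : (Fintype.card N : F) = 1 := by
    rw [← Nat.card_eq_fintype_card, hN]
    push_cast
    have := Fintype.ofFinite F
    rw [Nat.card_eq_fintype_card, FiniteField.cast_card_eq_zero F, zero_add]
  have key : ∀ v, form (∑ n : N, pullback (0, 0) n.1) v =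
      ∑ n : N, form (0, 0) (planeAct n.1 v) := by
    intro v
    have h1 : ∀ n : N, form (0, 0) (planeAct n.1 v) =
        (pullback (0, 0) n.1).1 * v.1 ^ 2 + v.1 * v.2 + (pullback (0, 0) n.1).2 * v.2 ^ 2 :=
      fun n => (form_pullback _ _ _).symm
    rw [Finset.sum_congr rfl fun n _ => h1 n]
    simp only [Finset.sum_add_distrib, ← Finset.sum_mul, Finset.sum_const, Finset.card_univ,
      nsmul_eq_mul, hone, form, Prod.fst_sum, Prod.snd_sum, one_mul]
  refine ⟨∑ n : N, pullback (0, 0) n.1, fun m hm => form_injective fun v => ?_⟩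
  rw [form_pullback, key, key]
  refine Fintype.sum_equiv (Equiv.mulRight ⟨m, hm⟩) _ _ fun n => ?_
  rw [Equiv.coe_mulRight, ← planeAct_mul]
  rfl

/-- A nontrivial group of odd order fixes at most one form. -/
theorem eq_of_forall_pullback_eq {N : Subgroup (SpecialLinearGroup (Fin 2) F)}
    (hodd : Odd (Nat.card N)) (hne : N ≠ ⊥) {p p' : F × F} (hp : ∀ n ∈ N, pullback p n = p)
    (hp' : ∀ n ∈ N, pullback p' n = p') : p = p' := by
  obtain ⟨u, rfl⟩ := exists_shift_eq p p'
  by_cases hu : u = 0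
  · rw [hu, shift_zero]
  refine absurd ((Subgroup.eq_bot_iff_forall N).2 fun n hn => ?_) hne
  have hn' : n ^ Nat.card N = 1 := by
    have : (⟨n, hn⟩ : N) ^ Nat.card N = 1 := pow_card_eq_one'
    exact congrArg Subtype.val this
  refine eq_one_of_planeAct_eq_self hodd hn' hu (polar_nondegenerate fun v => ?_)
  have h1 := form_eq_of_pullback_eq (hp' n hn) (planeAct n⁻¹ v)
  have h2 := form_eq_of_pullback_eq (hp n hn) (planeAct n⁻¹ v)
  rw [form_shift, form_shift, h2] at h1
  have h3 := sq_injective_of_algebra (add_left_cancel h1)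
  rw [planeAct_planeAct_inv] at h3
  rw [h3, ← polar_planeAct n u, planeAct_planeAct_inv]

theorem exists_isotropic {p : F × F} (hp : ¬ IsElliptic p) : ∃ v, v ≠ 0 ∧ form p v = 0 := by
  have h2 := two_eq_zero_of_algebra F
  by_cases h1 : p.1 = 0
  · exact ⟨(1, 0), by simp, by simp [form, h1]⟩
  · have h0 : Algebra.trace (ZMod 2) F (p.1 * p.2) = 0 := by
      by_contra h
      exact hp (zmod_two_eq_one h)
    obtain ⟨k, hk⟩ := exists_add_sq_eq h0
    refine ⟨(k / p.1, 1), by simp, ?_⟩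
    simp only [form]
    field_simp
    linear_combination hk + p.1 * p.2 * h2

/-- A form fixed by a group of order `q + 1` is elliptic. -/
theorem isElliptic_of_forall_pullback_eq {N : Subgroup (SpecialLinearGroup (Fin 2) F)}
    (hodd : Odd (Nat.card N)) (hN : Nat.card N = Nat.card F + 1) {p : F × F}
    (hp : ∀ n ∈ N, pullback p n = p) : IsElliptic p := by
  have h2 := two_eq_zero_of_algebra F
  by_contra hne
  obtain ⟨v, hv, hv0⟩ := exists_isotropic hne
  obtain ⟨w₀, hw₀⟩ := exists_polar_eq_one hv
  obtain ⟨w, hw, hw0⟩ : ∃ w, polar v w = 1 ∧ form p w = 0 := by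
    refine ⟨w₀ + form p w₀ • v, ?_, ?_⟩
    · rw [polar_add_right, polar_smul_right, polar_self, hw₀]
      ring
    · rw [form_add, form_smul, hv0, polar_smul_right, polar_comm, hw₀]
      linear_combination form p w₀ * h2
  have hpow : ∀ n ∈ N, n ^ Nat.card N = 1 := fun n hn => by
    have : (⟨n, hn⟩ : N) ^ Nat.card N = 1 := pow_card_eq_one'
    exact congrArg Subtype.val this
  have hform : ∀ u, form p u = polar u w * polar u v := fun u => by
    conv_lhs => rw [eq_of_polar_eq_one hw u]
    rw [form_add, form_smul, form_smul, hv0, hw0, polar_smul_left, polar_smul_right, hw]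
    ring
  have hline : ∀ n ∈ N, planeAct n v = polar (planeAct n v) w • v := by
    intro n hn
    have h1 := form_eq_of_pullback_eq (hp n hn) v
    rw [hv0, hform] at h1
    rcases mul_eq_zero.1 h1 with h | h
    · exfalso
      have e1 : planeAct n v = polar (planeAct n v) v • w := by
        conv_lhs => rw [eq_of_polar_eq_one hw (planeAct n v)]
        rw [h, zero_smul, zero_add]
      set b := polar (planeAct n v) v
      have h3 := form_eq_of_pullback_eq (hp n hn) w
      have h4 := polar_planeAct n v w
      rw [hw, e1, polar_smul_left, polar_comm] at h4
      rw [hw0, hform] at h3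
      have h5 : polar (planeAct n w) w ≠ 0 := by
        intro h6
        rw [h6, mul_zero] at h4
        exact zero_ne_one h4
      have h6 := (mul_eq_zero.1 h3).resolve_left h5
      have e2 : planeAct n w = polar (planeAct n w) w • v := by
        conv_lhs => rw [eq_of_polar_eq_one hw (planeAct n w)]
        rw [h6, zero_smul, add_zero]
      have e3 : planeAct (n ^ 2) v = v := by
        rw [sq, planeAct_mul, e1, planeAct_smul, e2, smul_smul, h4, one_smul]
      have e4 := eq_one_of_planeAct_eq_self hodd
        (by rw [← pow_mul, mul_comm, pow_mul, hpow n hn, one_pow]) hv e3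
      have e5 : n = 1 := by
        obtain ⟨j, hj⟩ := hodd
        have := hpow n hn
        rwa [hj, pow_succ, pow_mul, e4, one_pow, one_mul] at this
      rw [e5, planeAct_one, hw] at h
      exact one_ne_zero h
    · conv_lhs => rw [eq_of_polar_eq_one hw (planeAct n v)]
      rw [h, zero_smul, add_zero]
  have hinj : Function.Injective fun n : N => polar (planeAct n.1 v) w := by
    intro m n hmn
    have h1 : planeAct m.1 v = planeAct n.1 v := by
      rw [hline m.1 m.2, hline n.1 n.2]
      exact congrArg (· • v) hmn
    have h3 : planeAct (n.1⁻¹ * m.1) v = v := by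
      rw [planeAct_mul, h1, planeAct_inv_planeAct]
    have := eq_one_of_planeAct_eq_self hodd (hpow _ (N.mul_mem (N.inv_mem n.2) m.2)) hv h3
    exact Subtype.ext (inv_mul_eq_one.1 this).symm
  have := Nat.card_le_card_of_injective _ hinj
  omega

/-- A finite group of order twice an odd number has a normal subgroup of index two. -/
theorem exists_normal_card_eq {H : Type*} [Group H] [Finite H] {k : ℕ} (hk : Odd k)
    (hH : Nat.card H = 2 * k) : ∃ N : Subgroup H, N.Normal ∧ Nat.card N = k := by
  have hmin : (Nat.card H).minFac = 2 := by
    rw [hH, Nat.minFac_eq_two_iff]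
    exact Dvd.intro _ rfl
  let P : Sylow 2 H := default
  have hfact : Fact (Nat.Prime 2) := ⟨Nat.prime_two⟩
  have hP : Nat.card P = 2 := by
    rw [P.card_eq_multiplicity, hH, Nat.factorization_mul two_ne_zero hk.pos.ne']
    simp [Nat.prime_two.factorization_self,
      Nat.factorization_eq_zero_of_not_dvd hk.not_two_dvd_nat]
  have hcyc : IsCyclic P := isCyclic_of_prime_card hP
  have hc := (IsCyclic.isComplement' hmin hcyc).card_mul_card
  refine ⟨(MonoidHom.transferSylow P (hcyc.normalizer_le_centralizer hmin)).ker,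
    MonoidHom.normal_ker _, ?_⟩
  have h2 : Nat.card (P : Subgroup H) = 2 := hP
  rw [hH, h2] at hc
  omega

/-- A subgroup of order `2 (q + 1)` fixes an elliptic form. -/
theorem exists_isElliptic_of_card_eq (hF : 2 ∣ Nat.card F)
    (H : Subgroup (SpecialLinearGroup (Fin 2) F))
    (hH : Nat.card H = 2 * (Nat.card F + 1)) :
    ∃ p : F × F, IsElliptic p ∧ ∀ h ∈ H, pullback p h = p := by
  have hodd : Odd (Nat.card F + 1) := (even_iff_two_dvd.2 hF).add_one
  obtain ⟨N', hN', hcard'⟩ := exists_normal_card_eq hodd hH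
  let N : Subgroup (SpecialLinearGroup (Fin 2) F) := N'.map H.subtype
  have hcard : Nat.card N = Nat.card F + 1 := by
    rw [← hcard']
    exact (Nat.card_congr (N'.equivMapOfInjective H.subtype H.subtype_injective).toEquiv).symm
  have hne : N ≠ ⊥ := by
    intro h
    rw [h, Subgroup.card_bot] at hcard
    have := Nat.card_pos (α := F)
    omega
  have hconj : ∀ h ∈ H, ∀ n ∈ N, h * n * h⁻¹ ∈ N := by
    rintro h hh _ ⟨n, hn, rfl⟩
    exact ⟨(⟨h, hh⟩ : H) * n * (⟨h, hh⟩ : H)⁻¹, hN'.conj_mem n hn ⟨h, hh⟩, by simp⟩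
  obtain ⟨p, hp⟩ := exists_pullback_eq_of_card N hcard
  refine ⟨p, isElliptic_of_forall_pullback_eq (hcard ▸ hodd) hcard hp, fun h hh => ?_⟩
  refine (eq_of_forall_pullback_eq (hcard ▸ hodd) hne hp fun n hn => ?_).symm
  rw [← pullback_mul]
  have := hp _ (hconj h hh n hn)
  conv_rhs => rw [← this]
  rw [← pullback_mul]
  congr 1
  group

end Subgroups

/-! ### Identification of the points with the elliptic forms -/

section Model

variable {F : Type*} [Field F]

theorem card_specialLinearGroup_two [Finite F] : Nat.card (SpecialLinearGroup (Fin 2) F) =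
    Nat.card F * (Nat.card F - 1) * (Nat.card F + 1) := by
  have := Fintype.ofFinite F
  have hGL := Matrix.card_GL_field (𝔽 := F) 2
  simp only [Fin.prod_univ_two, Fin.val_zero, Fin.val_one, pow_zero, pow_one,
    ← Nat.card_eq_fintype_card] at hGL
  have hsurj : Function.Surjective (GeneralLinearGroup.det : GL (Fin 2) F →* Fˣ) := by
    intro u
    refine ⟨GeneralLinearGroup.mkOfDetNeZero !![(u : F), 0; 0, 1] (by simp), ?_⟩
    ext
    simp [GeneralLinearGroup.mkOfDetNeZero]
  have hker : Nat.card (GeneralLinearGroup.det : GL (Fin 2) F →* Fˣ).ker =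
      Nat.card (SpecialLinearGroup (Fin 2) F) := by
    refine Nat.card_congr
      { toFun := fun g => ⟨g.1.1, by
          have h := congrArg Units.val g.2
          simpa using h⟩
        invFun := fun m => ⟨SpecialLinearGroup.toGL m, by
          rw [MonoidHom.mem_ker]
          ext
          simp⟩
        left_inv := fun g => by ext; rfl
        right_inv := fun m => by ext; rfl }
  have hmul := (GeneralLinearGroup.det : GL (Fin 2) F →* Fˣ).ker.card_mul_index
  have hF := Nat.card_units F
  rw [Subgroup.index_ker, MonoidHom.range_eq_top.2 hsurj, Subgroup.card_top, hF, hker, hGL] at hmul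
  obtain ⟨k, hk⟩ : ∃ k, Nat.card F = k + 2 :=
    ⟨Nat.card F - 2, by have := Finite.one_lt_card (α := F); omega⟩
  rw [hk] at hmul ⊢
  have e1 : (k + 2) ^ 2 - 1 = (k + 1) * (k + 3) := by
    rw [Nat.sub_eq_iff_eq_add (Nat.one_le_pow _ _ (by omega))]
    ring
  have e2 : (k + 2) ^ 2 - (k + 2) = (k + 2) * (k + 1) := by
    rw [Nat.sub_eq_iff_eq_add (by nlinarith)]
    ring
  rw [e1, e2] at hmul
  refine Nat.eq_of_mul_eq_mul_right (show 0 < k + 2 - 1 by omega) (hmul.trans ?_)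
  simp only [show k + 2 - 1 = k + 1 by omega]
  ring

variable [Algebra (ZMod 2) F]

theorem card_isElliptic [Finite F] :
    Nat.card {p : F × F // IsElliptic p} = Nat.card F * (Nat.card F - 1) / 2 := by
  let e : {p : F × F // IsElliptic p} ≃
      {a : F // a ≠ 0} × {t : F // Algebra.trace (ZMod 2) F t = 1} :=
    { toFun := fun p => (⟨p.1.1, fun h => by simpa [IsElliptic, h] using p.2⟩, ⟨_, p.2⟩)
      invFun := fun x => ⟨(x.1.1, x.2.1 / x.1.1), by
        rw [IsElliptic, mul_div_cancel₀ _ x.1.2]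
        exact x.2.2⟩
      left_inv := fun p => by
        have : p.1.1 ≠ 0 := fun h => by simpa [IsElliptic, h] using p.2
        ext <;> simp [this]
      right_inv := fun x => by
        have := x.1.2
        ext <;> simp [mul_div_cancel₀ _ this] }
  obtain ⟨u, hu⟩ := Algebra.trace_surjective (ZMod 2) F 1
  have e' : {t : F // Algebra.trace (ZMod 2) F t = 1} ≃ traceZero F :=
    (Equiv.subRight u).subtypeEquiv fun t => by
      rw [traceZero, LinearMap.mem_ker, Equiv.subRight_apply, map_sub, hu, sub_eq_zero]
  have h0 : Nat.card {a : F // a ≠ 0} = Nat.card F - 1 := by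
    rw [← Nat.card_units]
    exact Nat.card_congr unitsEquivNeZero.symm
  rw [Nat.card_congr e, Nat.card_prod, Nat.card_congr e', h0, ← two_mul_card_traceZero (F := F),
    mul_assoc, Nat.mul_div_cancel_left _ two_pos, mul_comm]

variable {Ω : Type*}

/-- `Φ` identifies `Ω` with the elliptic forms, and `G` with the image of `SL(2, F)`. -/
structure IsEllipticModel (G : Subgroup (Equiv.Perm Ω)) (Φ : Ω → F × F) : Prop where
  injective : Function.Injective Φ
  isElliptic : ∀ ω, IsElliptic (Φ ω)
  surjective : ∀ p, IsElliptic p → ∃ ω, Φ ω = p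
  exists_matrix : ∀ g ∈ G, ∃ m : SpecialLinearGroup (Fin 2) F,
    ∀ ω v, form (Φ (g ω)) (planeAct m v) = form (Φ ω) v
  exists_perm : ∀ m : SpecialLinearGroup (Fin 2) F, ∃ g ∈ G,
    ∀ ω v, form (Φ (g ω)) (planeAct m v) = form (Φ ω) v

variable [Finite F] [Finite Ω]

theorem exists_isEllipticModel_range (hF : 2 ∣ Nat.card F)
    (φ : SpecialLinearGroup (Fin 2) F →* Equiv.Perm Ω) (hφ : ∀ ω ω' : Ω, ∃ m, φ m ω = ω')
    (hΩ : Nat.card Ω = Nat.card F * (Nat.card F - 1) / 2) :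
    ∃ Φ : Ω → F × F, IsEllipticModel φ.range Φ := by
  have hq := Finite.one_lt_card (α := F)
  have heven : Nat.card Ω * 2 = Nat.card F * (Nat.card F - 1) := by
    rw [hΩ, Nat.div_mul_cancel (hF.mul_right _)]
  have hpos : 0 < Nat.card Ω := by
    have : 0 < Nat.card F * (Nat.card F - 1) := Nat.mul_pos (by omega) (by omega)
    omega
  obtain ⟨ω₀⟩ := (Nat.card_pos_iff.1 hpos).1
  let H : Subgroup (SpecialLinearGroup (Fin 2) F) :=
    (MulAction.stabilizer (Equiv.Perm Ω) ω₀).comap φ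
  have hmem : ∀ m, m ∈ H ↔ φ m ω₀ = ω₀ := fun m => Iff.rfl
  have hidx : H.index = Nat.card Ω := by
    let _ : MulAction (SpecialLinearGroup (Fin 2) F) Ω := MulAction.compHom Ω φ
    have : MulAction.IsPretransitive (SpecialLinearGroup (Fin 2) F) Ω := ⟨hφ⟩
    exact MulAction.index_stabilizer_of_transitive (SpecialLinearGroup (Fin 2) F) ω₀
  have hH : Nat.card H = 2 * (Nat.card F + 1) := by
    have h := H.card_mul_index
    rw [hidx, card_specialLinearGroup_two, ← heven] at h
    exact Nat.eq_of_mul_eq_mul_right hpos (h.trans (by ring))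
  obtain ⟨p, hp, hfix⟩ := exists_isElliptic_of_card_eq hF H hH
  choose σ hσ using hφ ω₀
  have key : ∀ m, pullback p (σ (φ m ω₀))⁻¹ = pullback p m⁻¹ := by
    intro m
    have h1 : (σ (φ m ω₀))⁻¹ * m ∈ H := by
      rw [hmem, map_mul, map_inv, Equiv.Perm.mul_apply, Equiv.Perm.inv_eq_iff_eq, hσ]
    have h2 := hfix _ h1
    calc pullback p (σ (φ m ω₀))⁻¹ = pullback (pullback p ((σ (φ m ω₀))⁻¹ * m)) m⁻¹ := by
          rw [← pullback_mul, mul_inv_cancel_right]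
      _ = pullback p m⁻¹ := by rw [h2]
  have hact : ∀ (m : SpecialLinearGroup (Fin 2) F) (ω : Ω) (v : F × F),
      form (pullback p (σ (φ m ω))⁻¹) (planeAct m v) = form (pullback p (σ ω)⁻¹) v := by
    intro m ω v
    have h1 : φ m ω = φ (m * σ ω) ω₀ := by rw [map_mul, Equiv.Perm.mul_apply, hσ]
    rw [h1, key, _root_.mul_inv_rev, pullback_mul, form_pullback, planeAct_inv_planeAct]
  have hsurj : ∀ p', IsElliptic p' → ∃ ω, pullback p (σ ω)⁻¹ = p' := by
    intro p' hp'
    obtain ⟨v, hv⟩ := exists_form_eq hp 1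
    obtain ⟨v', hv'⟩ := exists_form_eq hp' 1
    obtain ⟨m, hm, -⟩ := hp'.exists_pullback hp (hv' ▸ one_ne_zero) (hv.trans hv'.symm)
    exact ⟨φ m⁻¹ ω₀, by rw [key, inv_inv, hm]⟩
  refine ⟨fun ω => pullback p (σ ω)⁻¹, ?_, fun ω => hp.pullback _, hsurj, ?_, ?_⟩
  · let f : Ω → {p : F × F // IsElliptic p} := fun ω => ⟨pullback p (σ ω)⁻¹, hp.pullback _⟩
    have hf : Function.Bijective f := by
      refine (Nat.bijective_iff_surjective_and_card f).2 ⟨?_, hΩ.trans card_isElliptic.symm⟩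
      rintro ⟨p', hp'⟩
      obtain ⟨ω, hω⟩ := hsurj p' hp'
      exact ⟨ω, Subtype.ext hω⟩
    exact fun a b hab => hf.1 (Subtype.ext hab)
  · rintro _ ⟨m, rfl⟩
    exact ⟨m, hact m⟩
  · exact fun m => ⟨φ m, ⟨m, rfl⟩, hact m⟩

theorem IsHollmannGroup.exists_isEllipticModel (hF : 2 ∣ Nat.card F)
    {G : Subgroup (Equiv.Perm Ω)} (hG : IsHollmannGroup F G) :
    ∃ Φ : Ω → F × F, IsEllipticModel G Φ := by
  obtain ⟨e⟩ := hG.iso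
  let ψ : SpecialLinearGroup (Fin 2) F →* G := e.symm.toMonoidHom.comp (QuotientGroup.mk' _)
  have hψ : Function.Surjective ψ := e.symm.surjective.comp (QuotientGroup.mk'_surjective _)
  have hrange : (G.subtype.comp ψ).range = G := by
    rw [MonoidHom.range_comp, MonoidHom.range_eq_top.2 hψ, ← MonoidHom.range_eq_map,
      Subgroup.range_subtype]
  have h := exists_isEllipticModel_range hF (G.subtype.comp ψ) (fun ω ω' => by
    obtain ⟨g, hg⟩ := hG.transitive.exists_smul_eq ω ω'
    obtain ⟨m, rfl⟩ := hψ g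
    exact ⟨m, hg⟩) hG.degree
  rwa [hrange] at h

end Model

/-! ### The labelling of the basis relations -/

section Labelling

variable {F : Type*} [Field F] {Ω : Type*}

/-- The pairs of forms which differ by the square of `polar v`, where `v` has value `x`. -/
def modelRel (Φ : Ω → F × F) (x : F) : Set (Ω × Ω) :=
  {p | ∃ v, Φ p.2 = shift (Φ p.1) v ∧ form (Φ p.1) v = x}

variable [Algebra (ZMod 2) F]

theorem mem_modelRel_iff {Φ : Ω → F × F} {β γ : Ω} {v : F × F}
    (h : Φ γ = shift (Φ β) v) (x : F) : (β, γ) ∈ modelRel Φ x ↔ form (Φ β) v = x := by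
  constructor
  · rintro ⟨w, hw, rfl⟩
    rw [shift_injective (h.symm.trans hw)]
  · exact fun hx => ⟨v, h, hx⟩

theorem mem_modelRel_iff_of_shift {Φ : Ω → F × F} {α β γ : Ω} {v w : F × F}
    (hv : Φ β = shift (Φ α) v) (hw : Φ γ = shift (Φ α) w) (z : F) :
    (β, γ) ∈ modelRel Φ z ↔
      form (Φ α) v + form (Φ α) w + (polar v w + polar v w ^ 2) = z := by
  have h : Φ γ = shift (Φ β) (v + w) := by
    rw [hv, hw, shift_shift, ← add_assoc, add_self_plane, zero_add]
  rw [mem_modelRel_iff h, hv, form_shift, form_add, polar_add_right, polar_self, zero_add,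
    add_assoc (_ + _)]

theorem add_sq_eq_zero {b : F} (h : b + b ^ 2 = 0) : b = 0 ∨ b = 1 := by
  have h2 := two_eq_zero_of_algebra F
  have : b * (b + 1) = 0 := by linear_combination h
  rcases mul_eq_zero.1 this with h | h
  · exact Or.inl h
  · exact Or.inr (by linear_combination h - h2)

/-- The reflection in `w` preserves the form and the product with `w`. -/
theorem form_reflection {p v w : F × F} (hw : form p w ≠ 0) :
    form p (v + (polar v w / form p w) • w) = form p v := by
  rw [form_add, form_smul, polar_smul_right]
  field_simp
  linear_combination polar v w ^ 2 * two_eq_zero_of_algebra F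

variable {G : Subgroup (Equiv.Perm Ω)} {Φ : Ω → F × F}

theorem IsEllipticModel.smul_mem (h : IsEllipticModel G Φ) {g : Equiv.Perm Ω} (hg : g ∈ G)
    {β γ : Ω} {x : F} (hx : (β, γ) ∈ modelRel Φ x) : (g β, g γ) ∈ modelRel Φ x := by
  obtain ⟨v, hv, hx⟩ := hx
  simp only at hv hx
  obtain ⟨m, hm⟩ := h.exists_matrix g hg
  refine ⟨planeAct m v, form_injective fun u => ?_, (hm β v).trans hx⟩
  rw [form_shift, ← planeAct_planeAct_inv m u, hm, hm, polar_planeAct, hv, form_shift]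

variable [Finite F]

theorem IsEllipticModel.exists_point (h : IsEllipticModel G Φ) (α : Ω) {v : F × F}
    (hv : Algebra.trace (ZMod 2) F (form (Φ α) v) = 0) : ∃ β, Φ β = shift (Φ α) v :=
  h.surjective _ ((isElliptic_shift_iff (h.isElliptic α)).2 hv)

theorem IsEllipticModel.trace_eq_zero (h : IsEllipticModel G Φ) {β γ : Ω} {x : F}
    (hx : (β, γ) ∈ modelRel Φ x) : Algebra.trace (ZMod 2) F x = 0 := by
  obtain ⟨v, hv, rfl⟩ := hx
  rw [← isElliptic_shift_iff (h.isElliptic _), ← hv]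
  exact h.isElliptic _

theorem IsEllipticModel.exists_mem (h : IsEllipticModel G Φ) (α : Ω) (x : traceZero F) :
    ∃ β, (α, β) ∈ modelRel Φ (x : F) := by
  obtain ⟨v, hv⟩ := exists_form_eq (h.isElliptic α) (x : F)
  obtain ⟨β, hβ⟩ := h.exists_point α (v := v) (hv ▸ x.2)
  exact ⟨β, v, hβ, hv⟩

theorem IsEllipticModel.exists_label (h : IsEllipticModel G Φ) (β γ : Ω) :
    ∃ x : traceZero F, (β, γ) ∈ modelRel Φ (x : F) := by
  obtain ⟨v, hv⟩ := exists_shift_eq (Φ β) (Φ γ)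
  have hm : (β, γ) ∈ modelRel Φ (form (Φ β) v) := ⟨v, hv, rfl⟩
  exact ⟨⟨_, h.trace_eq_zero hm⟩, hm⟩

theorem IsEllipticModel.exists_smul (h : IsEllipticModel G Φ) {β γ β' γ' : Ω} {x : F}
    (hx : (β, γ) ∈ modelRel Φ x) (hx' : (β', γ') ∈ modelRel Φ x) :
    ∃ g ∈ G, g β = β' ∧ g γ = γ' := by
  obtain ⟨v, hv, hx⟩ := hx
  obtain ⟨v', hv', hx'⟩ := hx'
  simp only at hv hx hv' hx'
  obtain ⟨m, hm, hmv⟩ : ∃ m : SpecialLinearGroup (Fin 2) F,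
      pullback (Φ β') m = Φ β ∧ planeAct m v = v' := by
    by_cases h0 : x = 0
    · obtain ⟨w, hw⟩ := exists_form_eq (h.isElliptic β) 1
      obtain ⟨w', hw'⟩ := exists_form_eq (h.isElliptic β') 1
      obtain ⟨m, hm, -⟩ := (h.isElliptic β).exists_pullback (h.isElliptic β')
        (hw ▸ one_ne_zero) (hw'.trans hw.symm)
      refine ⟨m, hm, ?_⟩
      rw [(h.isElliptic β).eq_zero (hx.trans h0), (h.isElliptic β').eq_zero (hx'.trans h0)]
      simp [planeAct]
    · exact (h.isElliptic β).exists_pullback (h.isElliptic β') (hx ▸ h0) (hx'.trans hx.symm)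
  obtain ⟨g, hg, hgm⟩ := h.exists_perm m
  have h1 : g β = β' := h.injective <| form_injective fun u => by
    rw [← planeAct_planeAct_inv m u, hgm, ← hm, form_pullback]
  refine ⟨g, hg, h1, h.injective <| form_injective fun u => ?_⟩
  rw [← planeAct_planeAct_inv m u, hgm, hv, hv', form_shift, form_shift, ← hm, form_pullback,
    ← hmv, polar_planeAct]

theorem IsEllipticModel.orbit_eq (h : IsEllipticModel G Φ) {p : Ω × Ω} {x : F}
    (hp : p ∈ modelRel Φ x) : MulAction.orbit G p = modelRel Φ x := by
  ext q
  constructor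
  · rintro ⟨g, rfl⟩
    exact h.smul_mem g.2 hp
  · intro hq
    obtain ⟨g, hg, h1, h2⟩ := h.exists_smul (β := p.1) (γ := p.2) (β' := q.1) (γ' := q.2) hp hq
    exact ⟨⟨g, hg⟩, Prod.ext h1 h2⟩

theorem IsEllipticModel.modelRel_zero (h : IsEllipticModel G Φ) :
    modelRel Φ 0 = Set.diagonal Ω := by
  ext ⟨β, γ⟩
  constructor
  · rintro ⟨v, hv, hx⟩
    simp only at hv hx
    rw [(h.isElliptic β).eq_zero hx, shift_zero] at hv
    exact (h.injective hv).symm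
  · intro hβγ
    have : β = γ := hβγ
    subst this
    exact ⟨0, (shift_zero _).symm, by simp [form]⟩

theorem IsEllipticModel.bijOn (h : IsEllipticModel G Φ) [Nonempty Ω] :
    Set.BijOn (fun x : traceZero F => modelRel Φ (x : F)) Set.univ (inv G).basis := by
  refine ⟨fun x _ => ?_, fun x _ y _ hxy => ?_, ?_⟩
  · obtain ⟨β, hβ⟩ := h.exists_mem (Classical.arbitrary Ω) x
    exact ⟨_, h.orbit_eq hβ⟩
  · obtain ⟨β, v, hβ, hv⟩ := h.exists_mem (Classical.arbitrary Ω) x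
    have h1 : (Classical.arbitrary Ω, β) ∈ modelRel Φ (x : F) := ⟨v, hβ, hv⟩
    have hxy' : modelRel Φ (x : F) = modelRel Φ (y : F) := hxy
    rw [hxy', mem_modelRel_iff hβ] at h1
    exact Subtype.ext (hv.symm.trans h1)
  · rintro _ ⟨⟨β, γ⟩, rfl⟩
    obtain ⟨x, hx⟩ := h.exists_label β γ
    exact ⟨x, Set.mem_univ _, (h.orbit_eq hx).symm⟩

/-- The number of paths with prescribed labels, counted by vectors. -/
theorem IsEllipticModel.pathCount_eq (h : IsEllipticModel G Φ) {β γ : Ω} {w : F × F}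
    (hw : Φ γ = shift (Φ β) w) (x y : traceZero F) :
    pathCount (modelRel Φ (x : F)) (modelRel Φ (y : F)) β γ =
      {v | form (Φ β) v = x ∧
        (x : F) + form (Φ β) w + (polar v w + polar v w ^ 2) = y}.ncard := by
  symm
  have hex : ∀ v, form (Φ β) v = x → ∃ δ, Φ δ = shift (Φ β) v := fun v hv =>
    h.exists_point β (hv ▸ x.2)
  refine Set.ncard_congr (fun v hv => (hex v hv.1).choose) ?_ ?_ ?_
  · rintro v ⟨hv, hy⟩
    have hδ := (hex v hv).choose_spec
    refine ⟨(mem_modelRel_iff hδ _).2 hv, (mem_modelRel_iff_of_shift hδ hw _).2 ?_⟩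
    rw [hv, hy]
  · intro v v' hv hv' heq
    have h1 := (hex v hv.1).choose_spec
    have h2 := (hex v' hv'.1).choose_spec
    rw [heq, h2] at h1
    exact (shift_injective h1).symm
  · rintro δ ⟨⟨v, hδ, hv⟩, hδ'⟩
    simp only at hδ hv
    have h1 := (mem_modelRel_iff_of_shift hδ hw _).1 hδ'
    rw [hv] at h1
    exact ⟨v, ⟨hv, h1⟩, h.injective ((hex v hv).choose_spec.trans hδ.symm)⟩

theorem ncard_form_polar_eq_one_iff {p w : F × F} (hp : IsElliptic p) (hw : form p w ≠ 0)
    (x y : F) :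
    {v | form p v = x ∧ x + form p w + (polar v w + polar v w ^ 2) = y}.ncard = 1 ↔
      Algebra.trace (ZMod 2) F (x * form p w) = 0 ∧ x + y + form p w = 0 := by
  have h2 := two_eq_zero_of_algebra F
  have hw0 : w ≠ 0 := ne_zero_of_form_eq rfl hw
  obtain ⟨k, hk⟩ := exists_sq_eq (x / form p w)
  have hkw : form p (k • w) = x := by
    rw [form_smul, hk, div_mul_cancel₀ _ hw]
  have hkw' : polar (k • w) w = 0 := by rw [polar_smul_left, polar_self, mul_zero]
  rw [Set.ncard_eq_one]
  constructor
  · rintro ⟨v, hv⟩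
    have hmem : form p v = x ∧ x + form p w + (polar v w + polar v w ^ 2) = y := by
      have : v ∈ ({v} : Set (F × F)) := rfl
      rwa [← hv] at this
    have huniq : ∀ u, form p u = x → x + form p w + (polar u w + polar u w ^ 2) = y → u = v := by
      intro u h1 h3
      have : u ∈ ({v} : Set (F × F)) := hv ▸ ⟨h1, h3⟩
      exact this
    have hpol : polar v w = 0 := by
      have h3 := huniq (v + (polar v w / form p w) • w) ((form_reflection hw).trans hmem.1) (by
        rw [polar_add_left, polar_smul_left, polar_self, mul_zero, add_zero]
        exact hmem.2)
      have h4 : (polar v w / form p w) • w = 0 := by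
        simpa using h3
      have h5 := (smul_eq_zero.1 h4).resolve_right hw0
      exact (div_eq_zero_iff.1 h5).resolve_right hw
    have hsum : x + form p w = y := by
      have := hmem.2
      rw [hpol] at this
      linear_combination this
    refine ⟨?_, by linear_combination hsum + y * h2⟩
    by_contra hne
    obtain ⟨u, hu1, hu2⟩ := hp.exists_basis hw (c := x) (by
      rw [mul_comm]
      exact zmod_two_eq_one hne)
    rw [polar_comm] at hu1
    have h3 := huniq u hu2 (by
      rw [hu1]
      linear_combination hsum + h2)
    rw [h3, hpol] at hu1
    exact zero_ne_one hu1
  · rintro ⟨htr, hsum⟩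
    refine ⟨k • w, Set.eq_singleton_iff_unique_mem.2 ⟨⟨hkw, ?_⟩, ?_⟩⟩
    · rw [hkw']
      linear_combination hsum - y * h2
    · rintro u ⟨hu1, hu2⟩
      rcases add_sq_eq_zero (b := polar u w) (by linear_combination hu2 - hsum + y * h2)
        with h3 | h3
      · obtain ⟨l, rfl⟩ := exists_smul_eq_of_polar_eq_zero hw0 h3
        rw [form_smul, ← hkw, form_smul] at hu1
        rw [sq_injective_of_algebra (mul_right_cancel₀ hw hu1)]
      · have := hp.trace_mul h3
        rw [hu1, htr] at this
        exact absurd this zero_ne_one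

theorem IsEllipticModel.isHollmannLabelling (h : IsEllipticModel G Φ) [Nonempty Ω] :
    IsHollmannLabelling (inv G) fun x : traceZero F => modelRel Φ (x : F) where
  bijOn := h.bijOn
  zero := h.modelRel_zero
  intersection := by
    rintro x y z hz β γ ⟨w, hw, hwz⟩
    simp only at hw hwz
    have hz' : form (Φ β) w ≠ 0 := by
      rw [hwz]
      exact fun h0 => hz (Subtype.ext h0)
    rw [h.pathCount_eq hw, ncard_form_polar_eq_one_iff (h.isElliptic β) hz', hwz,
      ← Submodule.coe_add, ← Submodule.coe_add, ZeroMemClass.coe_eq_zero]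

end Labelling

/-! ### Relations of coherent configurations -/

section Relations

variable {Ω : Type*} {Y : CoherentConfiguration Ω}

/-- The composition of two relations. -/
def relComp (r s : Set (Ω × Ω)) : Set (Ω × Ω) := {p | ∃ c, (p.1, c) ∈ r ∧ (c, p.2) ∈ s}

theorem CoherentConfiguration.inter_mem_relations {r s : Set (Ω × Ω)} (hr : r ∈ Y.relations)
    (hs : s ∈ Y.relations) : r ∩ s ∈ Y.relations := by
  have h1 := (mem_unions_iff Y.isPartition).1 hr
  have h2 := (mem_unions_iff Y.isPartition).1 hs
  exact (mem_unions_iff Y.isPartition).2 fun t ht p hp q hq hpq =>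
    ⟨h1 t ht p hp q hq hpq.1, h2 t ht p hp q hq hpq.2⟩

theorem CoherentConfiguration.relStar_mem_relations {r : Set (Ω × Ω)} (hr : r ∈ Y.relations) :
    relStar r ∈ Y.relations := by
  have h := (mem_unions_iff Y.isPartition).1 hr
  refine (mem_unions_iff Y.isPartition).2 fun t ht a ha b hb har => ?_
  have ht' : relStar t ∈ Y.basis := by
    rw [← Y.star_eq]
    exact ⟨t, ht, rfl⟩
  exact h (relStar t) ht' (a.2, a.1) ha (b.2, b.1) hb har

theorem CoherentConfiguration.diagonal_mem_relations : Set.diagonal Ω ∈ Y.relations := by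
  have h := Y.diag_mem
  have e : diagOn (Set.univ : Set Ω) = Set.diagonal Ω := by
    ext p
    simp [diagOn]
  rwa [e] at h

theorem exists_smul_of_mem_nbr {G : Subgroup (Equiv.Perm Ω)} {α β γ : Ω} {s : Set (Ω × Ω)}
    (hs : s ∈ (inv G).basis) (hβ : β ∈ nbr α s) (hγ : γ ∈ nbr α s) :
    ∃ g ∈ G, g α = α ∧ g β = γ := by
  obtain ⟨p, rfl⟩ := hs
  have h : (α, γ) ∈ MulAction.orbit G (α, β) := by
    rw [MulAction.orbit_eq_iff.2 hβ]
    exact hγ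
  obtain ⟨g, hg⟩ := h
  exact ⟨g.1, g.2, congrArg Prod.fst hg, congrArg Prod.snd hg⟩

variable [Finite Ω]

theorem CoherentConfiguration.pathCount_mem_relations {r s : Set (Ω × Ω)} (hr : r ∈ Y.relations)
    (hs : s ∈ Y.relations) (P : ℕ → Prop) :
    {p : Ω × Ω | P (pathCount r s p.1 p.2)} ∈ Y.relations := by
  refine (mem_unions_iff Y.isPartition).2 fun t ht a ha b hb h => ?_
  change P _
  rw [← pathCount_congr Y hr hs ht ha hb]
  exact h

theorem CoherentConfiguration.relComp_mem_relations {r s : Set (Ω × Ω)} (hr : r ∈ Y.relations)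
    (hs : s ∈ Y.relations) : relComp r s ∈ Y.relations := by
  have e : relComp r s = {p : Ω × Ω | pathCount r s p.1 p.2 ≠ 0} := by
    ext p
    change (∃ c, _) ↔ (Set.ncard _ ≠ 0)
    rw [Ne, Set.ncard_eq_zero, ← Ne, ← Set.nonempty_iff_ne_empty]
    rfl
  rw [e]
  exact pathCount_mem_relations hr hs (· ≠ 0)

/-! ### Point extensions -/

theorem CoherentConfiguration.basis_subset_pointExtension (X : CoherentConfiguration Ω) (α : Ω)
    {s : Set (Ω × Ω)} (hs : s ∈ X.basis) : s ∈ (X.pointExtension α).relations :=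
  (coherentClosure_isLeast (X.basis ∪ {diagOn {α}})).1 (Or.inl hs)

theorem CoherentConfiguration.nbr_prod_nbr_mem_relations (X : CoherentConfiguration Ω) (α : Ω)
    {s t : Set (Ω × Ω)} (hs : s ∈ X.basis) (ht : t ∈ X.basis) :
    nbr α s ×ˢ nbr α t ∈ (X.pointExtension α).relations := by
  have hα : diagOn {α} ∈ (X.pointExtension α).relations :=
    (coherentClosure_isLeast (X.basis ∪ {diagOn {α}})).1 (Or.inr rfl)
  have h1 := relComp_mem_relations hα (X.basis_subset_pointExtension α hs)
  have h2 := relComp_mem_relations hα (X.basis_subset_pointExtension α ht)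
  convert relComp_mem_relations (relStar_mem_relations h1) h2 using 1
  ext ⟨β, γ⟩
  constructor
  · rintro ⟨hβ, hγ⟩
    exact ⟨α, ⟨α, ⟨rfl, rfl⟩, hβ⟩, ⟨α, ⟨rfl, rfl⟩, hγ⟩⟩
  · rintro ⟨c, ⟨a, ⟨hca, hc⟩, hβ⟩, ⟨b, ⟨hcb, -⟩, hγ⟩⟩
    simp only [Set.mem_singleton_iff] at hca hc hcb
    subst hca hcb hc
    exact ⟨hβ, hγ⟩

/-- The relations of the point extension are invariant under the point stabilizer. -/
theorem smul_mem_of_mem_pointExtension {G : Subgroup (Equiv.Perm Ω)} {α : Ω} {r : Set (Ω × Ω)}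
    (hr : r ∈ ((inv G).pointExtension α).relations) {g : Equiv.Perm Ω} (hg : g ∈ G)
    (hgα : g α = α) {β γ : Ω} (h : (β, γ) ∈ r) : (g β, g γ) ∈ r := by
  let K : Subgroup (Equiv.Perm Ω) := G ⊓ MulAction.stabilizer (Equiv.Perm Ω) α
  have hK : (inv G).basis ∪ {diagOn {α}} ⊆ (inv K).relations := by
    rintro t (⟨p, rfl⟩ | rfl)
    · refine (mem_unions_iff (inv K).isPartition).2 ?_
      rintro _ ⟨o, rfl⟩ a ⟨k, rfl⟩ b ⟨l, rfl⟩ ⟨m, hm⟩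
      refine ⟨⟨l.1, l.2.1⟩ * ⟨k.1, k.2.1⟩⁻¹ * m, ?_⟩
      simp only at hm ⊢
      rw [mul_smul, hm, mul_smul]
      exact congrArg (l.1 • ·) (inv_smul_smul k.1 o)
    · refine (mem_unions_iff (inv K).isPartition).2 ?_
      rintro _ ⟨o, rfl⟩ a ⟨k, rfl⟩ b ⟨l, rfl⟩ ⟨hm1, hm2⟩
      have h1 : k.1 o.1 = k.1 o.2 := hm1
      have h2 : k.1 o.1 = α := hm2
      have h3 : k.1 α = α := k.2.2
      have h4 : l.1 α = α := l.2.2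
      have h5 : o.1 = α := k.1.injective (h2.trans h3.symm)
      have h6 : o.2 = α := (k.1.injective h1).symm.trans h5
      refine ⟨?_, ?_⟩
      · change l.1 o.1 = l.1 o.2
        rw [h5, h6]
      · change l.1 o.1 = α
        rw [h5, h4]
  have hr' := (coherentClosure_isLeast ((inv G).basis ∪ {diagOn {α}})).2 hK hr
  exact (mem_unions_iff (inv K).isPartition).1 hr' _ ⟨(β, γ), rfl⟩ (β, γ)
    (MulAction.mem_orbit_self _) (g β, g γ) ⟨⟨g, hg, hgα⟩, rfl⟩ h

/-- A relation of the point extension which is an orbit of the point stabilizer is basic. -/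
theorem mem_basis_pointExtension {G : Subgroup (Equiv.Perm Ω)} {α : Ω} {r : Set (Ω × Ω)}
    (hr : r ∈ ((inv G).pointExtension α).relations) (hne : r.Nonempty)
    (horb : ∀ p ∈ r, ∀ q ∈ r, ∃ g ∈ G, g α = α ∧ g p.1 = q.1 ∧ g p.2 = q.2) :
    r ∈ ((inv G).pointExtension α).basis := by
  obtain ⟨p, hp⟩ := hne
  obtain ⟨t, ⟨ht, hpt⟩, -⟩ := ((inv G).pointExtension α).isPartition.2 p
  have htr : t ∈ ((inv G).pointExtension α).relations :=
    ⟨{t}, Set.singleton_subset_iff.2 ht, (Set.sUnion_singleton t).symm⟩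
  have : r = t := by
    refine Set.Subset.antisymm (fun q hq => ?_) fun q hq =>
      (mem_unions_iff ((inv G).pointExtension α).isPartition).1 hr t ht p hpt q hq hp
    obtain ⟨g, hg, hgα, h1, h2⟩ := horb p hp q hq
    have := smul_mem_of_mem_pointExtension htr hg hgα hpt
    rwa [h1, h2] at this
  rwa [this]

theorem nbr_mem_fibers {G : Subgroup (Equiv.Perm Ω)} {α : Ω} {s : Set (Ω × Ω)}
    (hs : s ∈ (inv G).basis) (hne : (nbr α s).Nonempty) :
    nbr α s ∈ ((inv G).pointExtension α).fibers := by
  refine mem_basis_pointExtension ?_ ?_ ?_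
  · convert CoherentConfiguration.inter_mem_relations
      ((inv G).nbr_prod_nbr_mem_relations α hs hs)
      CoherentConfiguration.diagonal_mem_relations using 1
    ext ⟨β, γ⟩
    constructor
    · rintro ⟨h1, h2⟩
      simp only at h1 h2
      subst h1
      exact ⟨⟨h2, h2⟩, rfl⟩
    · rintro ⟨⟨h1, -⟩, h2⟩
      exact ⟨h2, h1⟩
  · obtain ⟨β, hβ⟩ := hne
    exact ⟨(β, β), rfl, hβ⟩
  · rintro ⟨β, β'⟩ ⟨h1, h2⟩ ⟨γ, γ'⟩ ⟨h3, h4⟩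
    simp only at h1 h2 h3 h4
    subst h1 h3
    obtain ⟨g, hg, hgα, h⟩ := exists_smul_of_mem_nbr hs h2 h4
    exact ⟨g, hg, hgα, h, h⟩

/-- A relation of the point extension which is the graph of a bijection between two
neighbourhoods of the point is a matching. -/
theorem isMatching_of_existsUnique {G : Subgroup (Equiv.Perm Ω)} {α : Ω}
    {s t r : Set (Ω × Ω)} (hs : s ∈ (inv G).basis) (ht : t ∈ (inv G).basis)
    (hne : (nbr α s).Nonempty) (hr : r ∈ ((inv G).pointExtension α).relations)
    (hsub : r ⊆ nbr α s ×ˢ nbr α t) (h1 : ∀ δ ∈ nbr α s, ∃! γ, (δ, γ) ∈ r)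
    (h2 : ∀ γ ∈ nbr α t, ∃! δ, (δ, γ) ∈ r) :
    r ∈ ((inv G).pointExtension α).basisBetween (nbr α s) (nbr α t) ∧
      ((inv G).pointExtension α).IsMatching r := by
  obtain ⟨δ, hδ⟩ := hne
  obtain ⟨γ, hγ, -⟩ := h1 δ hδ
  have hb : r ∈ ((inv G).pointExtension α).basis := by
    refine mem_basis_pointExtension hr ⟨_, hγ⟩ ?_
    rintro ⟨a, b⟩ hab ⟨a', b'⟩ hab'
    obtain ⟨g, hg, hgα, h⟩ := exists_smul_of_mem_nbr hs (hsub hab).1 (hsub hab').1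
    refine ⟨g, hg, hgα, h, ?_⟩
    have h3 := smul_mem_of_mem_pointExtension hr hg hgα hab
    simp only at h
    rw [h] at h3
    exact (h1 a' (hsub hab').1).unique h3 hab'
  have hb' : relStar r ∈ ((inv G).pointExtension α).basis := by
    rw [← ((inv G).pointExtension α).star_eq]
    exact ⟨r, hb, rfl⟩
  have hfs := nbr_mem_fibers hs ⟨δ, hδ⟩
  have hft := nbr_mem_fibers ht ⟨γ, (hsub hγ).2⟩
  have hcard : ∀ {A : Set Ω}, (∃! c, c ∈ A) → A.ncard = 1 := by
    rintro A ⟨c, hc, hu⟩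
    exact Set.ncard_eq_one.2 ⟨c, Set.eq_singleton_iff_unique_mem.2 ⟨hc, hu⟩⟩
  exact ⟨⟨hb, hsub⟩, hb, ⟨_, hfs, _, hft, ⟨hb, hsub⟩, fun a ha => hcard (h1 a ha)⟩,
    ⟨_, hft, _, hfs, ⟨hb', fun p hp => ⟨(hsub hp).2, (hsub hp).1⟩⟩,
      fun a ha => hcard (h2 a ha)⟩⟩

end Relations

/-! ### Matchings in the point extension -/

section Matching

variable {F : Type*} [Field F] {Ω : Type*}

/-- The graph of the scalar multiplication between the vectors of values `x` and `y`. -/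
def matchRel (Φ : Ω → F × F) (α : Ω) (x y : F) : Set (Ω × Ω) :=
  {p | ∃ v w, Φ p.1 = shift (Φ α) v ∧ Φ p.2 = shift (Φ α) w ∧ form (Φ α) v = x ∧
    form (Φ α) w = y ∧ polar v w = 0}

theorem relStar_matchRel (Φ : Ω → F × F) (α : Ω) (x y : F) :
    relStar (matchRel Φ α x y) = matchRel Φ α y x := by
  ext ⟨β, γ⟩
  constructor
  · rintro ⟨v, w, h1, h2, h3, h4, h5⟩
    exact ⟨w, v, h2, h1, h4, h3, polar_comm v w ▸ h5⟩
  · rintro ⟨v, w, h1, h2, h3, h4, h5⟩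
    exact ⟨w, v, h2, h1, h4, h3, polar_comm v w ▸ h5⟩

theorem matchRel_subset (Φ : Ω → F × F) (α : Ω) (x y : F) :
    matchRel Φ α x y ⊆ nbr α (modelRel Φ x) ×ˢ nbr α (modelRel Φ y) := by
  rintro ⟨β, γ⟩ ⟨v, w, h1, h2, h3, h4, -⟩
  exact ⟨⟨v, h1, h3⟩, ⟨w, h2, h4⟩⟩

variable [Algebra (ZMod 2) F] [Finite F] {G : Subgroup (Equiv.Perm Ω)} {Φ : Ω → F × F}

theorem IsEllipticModel.existsUnique_matchRel (h : IsEllipticModel G Φ) (α : Ω)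
    {x y : traceZero F} (hx : x ≠ 0) (hy : y ≠ 0) {β : Ω} (hβ : β ∈ nbr α (modelRel Φ (x : F))) :
    ∃! γ, (β, γ) ∈ matchRel Φ α (x : F) (y : F) := by
  have hx' : (x : F) ≠ 0 := fun h0 => hx (Subtype.ext h0)
  have hy' : (y : F) ≠ 0 := fun h0 => hy (Subtype.ext h0)
  obtain ⟨v, hv, hvx⟩ := hβ
  simp only at hv hvx
  obtain ⟨k, hk⟩ := exists_sq_eq ((y : F) / x)
  have hform : form (Φ α) (k • v) = y := by
    rw [form_smul, hk, hvx, div_mul_cancel₀ _ hx']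
  obtain ⟨γ, hγ⟩ := h.exists_point α (v := k • v) (hform ▸ y.2)
  refine ⟨γ, ⟨v, k • v, hv, hγ, hvx, hform, by rw [polar_smul_right, polar_self, mul_zero]⟩, ?_⟩
  rintro γ' ⟨v', w, h1, h2, -, h4, h5⟩
  simp only at h1 h2
  obtain rfl : v = v' := shift_injective (hv.symm.trans h1)
  refine h.injective (h2.trans ?_)
  rw [hγ, eq_of_polar_eq_zero (p := Φ α) (v := w) (w := k • v) (hform ▸ hy') _
    (h4.trans hform.symm)]
  rw [polar_smul_right, polar_comm, h5, mul_zero]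

theorem IsEllipticModel.modelRel_mem_basis (h : IsEllipticModel G Φ) (α : Ω) (x : traceZero F) :
    modelRel Φ (x : F) ∈ (inv G).basis := by
  have : Nonempty Ω := ⟨α⟩
  exact h.bijOn.mapsTo (Set.mem_univ x)

variable [Finite Ω]

theorem IsEllipticModel.matchRel_self_mem_relations (h : IsEllipticModel G Φ) (α : Ω)
    {x : traceZero F} (hx : x ≠ 0) :
    matchRel Φ α (x : F) (x : F) ∈ ((inv G).pointExtension α).relations := by
  have hx' : (x : F) ≠ 0 := fun h0 => hx (Subtype.ext h0)
  have hb := h.modelRel_mem_basis α x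
  convert CoherentConfiguration.inter_mem_relations
    ((inv G).nbr_prod_nbr_mem_relations α hb hb)
    CoherentConfiguration.diagonal_mem_relations using 1
  ext ⟨β, γ⟩
  constructor
  · rintro ⟨v, w, h1, h2, h3, h4, h5⟩
    simp only at h1 h2
    obtain rfl := eq_of_polar_eq_zero (h4.trans_ne hx') h5 (h3.trans h4.symm)
    exact ⟨⟨⟨v, h1, h3⟩, ⟨v, h2, h3⟩⟩, h.injective (h1.trans h2.symm)⟩
  · rintro ⟨⟨⟨v, h1, h2⟩, -⟩, h3⟩
    have h3' : β = γ := h3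
    subst h3'
    exact ⟨v, v, h1, h1, h2, h2, polar_self v⟩

theorem IsEllipticModel.matchRel_mem_relations_of_ne (h : IsEllipticModel G Φ) (α : Ω)
    {x y : traceZero F} (hx : x ≠ 0) (hy : y ≠ 0) (hxy : x ≠ y) (h1 : (x : F) * y ≠ 1)
    (h1y : (x : F) * y ≠ 1 + (y : F) ^ 2) :
    matchRel Φ α (x : F) (y : F) ∈ ((inv G).pointExtension α).relations := by
  have h2 := two_eq_zero_of_algebra F
  have hx' : (x : F) ≠ 0 := fun h0 => hx (Subtype.ext h0)
  have hy' : (y : F) ≠ 0 := fun h0 => hy (Subtype.ext h0)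
  obtain ⟨k, hk⟩ := exists_sq_eq ((x : F) / y)
  have hky : k ^ 2 * y = x := by rw [hk, div_mul_cancel₀ _ hy']
  have hk0 : k ≠ 0 := by
    rintro rfl
    exact hx' (by rw [← hky]; ring)
  have hk1 : k ≠ 1 := by
    rintro rfl
    exact hxy (Subtype.ext (by rw [← hky]; ring))
  let t : traceZero F := ⟨k + k ^ 2, trace_add_sq k⟩
  have hbx := h.modelRel_mem_basis α x
  have hby := h.modelRel_mem_basis α y
  have hC := CoherentConfiguration.inter_mem_relations
    ((inv G).nbr_prod_nbr_mem_relations α hbx hbx)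
    ((inv G).basis_subset_pointExtension α (h.modelRel_mem_basis α t))
  have hR := CoherentConfiguration.inter_mem_relations
    ((inv G).nbr_prod_nbr_mem_relations α hbx hby)
    ((inv G).basis_subset_pointExtension α (h.modelRel_mem_basis α (x + y)))
  set C := nbr α (modelRel Φ (x : F)) ×ˢ nbr α (modelRel Φ (x : F)) ∩ modelRel Φ (t : F)
    with hCdef
  set R := nbr α (modelRel Φ (x : F)) ×ˢ nbr α (modelRel Φ (y : F)) ∩
    modelRel Φ ((x + y : traceZero F) : F) with hRdef
  have memR : ∀ {β γ : Ω} {v w : F × F}, Φ β = shift (Φ α) v → Φ γ = shift (Φ α) w →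
      ((β, γ) ∈ R ↔ form (Φ α) v = x ∧ form (Φ α) w = y ∧ (polar v w = 0 ∨ polar v w = 1)) := by
    intro β γ v w hv hw
    rw [hRdef]
    change (((α, β) ∈ modelRel Φ (x : F) ∧ (α, γ) ∈ modelRel Φ (y : F)) ∧ _) ↔ _
    rw [mem_modelRel_iff hv, mem_modelRel_iff hw, mem_modelRel_iff_of_shift hv hw, and_assoc]
    refine and_congr_right fun e1 => and_congr_right fun e2 => ?_
    rw [e1, e2, Submodule.coe_add, add_eq_left]
    refine ⟨add_sq_eq_zero, ?_⟩
    rintro (e | e)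
    · rw [e]; ring
    · rw [e]; linear_combination h2
  have memC : ∀ {β γ : Ω} {v w : F × F}, Φ β = shift (Φ α) v → Φ γ = shift (Φ α) w →
      ((β, γ) ∈ C ↔ form (Φ α) v = x ∧ form (Φ α) w = x ∧
        (polar v w = k ∨ polar v w = k + 1)) := by
    intro β γ v w hv hw
    rw [hCdef]
    change (((α, β) ∈ modelRel Φ (x : F) ∧ (α, γ) ∈ modelRel Φ (x : F)) ∧ _) ↔ _
    rw [mem_modelRel_iff hv, mem_modelRel_iff hw, mem_modelRel_iff_of_shift hv hw, and_assoc]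
    refine and_congr_right fun e1 => and_congr_right fun e2 => ?_
    change _ = k + k ^ 2 ↔ _
    rw [e1, e2]
    constructor
    · intro e
      rcases add_sq_eq_zero (b := polar v w + k) (by
        linear_combination e + (polar v w * k + k + k ^ 2 - x) * h2) with e' | e'
      · exact Or.inl (by linear_combination e' - k * h2)
      · exact Or.inr (by linear_combination e' - k * h2)
    · rintro (e | e)
      · rw [e]; linear_combination x * h2
      · rw [e]; linear_combination (x + k + 1) * h2
  convert CoherentConfiguration.inter_mem_relations hR
    (CoherentConfiguration.pathCount_mem_relations hC hR (· ≠ 1)) using 1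
  ext ⟨β, γ⟩
  constructor
  · rintro ⟨v, w, hv, hw, hvx, hwy, hvw⟩
    simp only at hv hw
    refine ⟨(memR hv hw).2 ⟨hvx, hwy, Or.inl hvw⟩, fun hone => ?_⟩
    obtain ⟨δ, hδ⟩ := Set.ncard_eq_one.1 hone
    have hmem : (β, δ) ∈ C ∧ (δ, γ) ∈ R := by
      have : δ ∈ ({δ} : Set Ω) := rfl
      rwa [← hδ] at this
    obtain ⟨u, hu, hux⟩ := hmem.1.1.2
    simp only at hu hux
    obtain ⟨-, -, hc⟩ := (memC hv hu).1 hmem.1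
    obtain ⟨-, -, hr⟩ := (memR hu hw).1 hmem.2
    have hw0 : form (Φ α) w ≠ 0 := hwy.trans_ne hy'
    obtain ⟨l, rfl⟩ := exists_smul_eq_of_polar_eq_zero (ne_zero_of_form_eq rfl hw0) hvw
    rcases hr with hr | hr
    · rw [polar_smul_left, polar_comm, hr, mul_zero] at hc
      rcases hc with hc | hc
      · exact hk0 hc.symm
      · exact hk1 (by linear_combination (-1 : F) * hc - h2)
    · have hrefl : form (Φ α) (u + (polar u w / form (Φ α) w) • w) = x :=
        (form_reflection hw0).trans hux
      obtain ⟨ε, hε⟩ := h.exists_point α (hrefl ▸ x.2 :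
        Algebra.trace (ZMod 2) F (form (Φ α) (u + (polar u w / form (Φ α) w) • w)) = 0)
      have hε' : (β, ε) ∈ C ∧ (ε, γ) ∈ R := by
        refine ⟨(memC hv hε).2 ⟨hvx, hrefl, ?_⟩, (memR hε hw).2 ⟨hrefl, hwy, ?_⟩⟩
        · rwa [polar_add_right, polar_smul_right _ _ w, polar_smul_left l w w, polar_self,
            mul_zero, mul_zero, add_zero]
        · rw [polar_add_left, polar_smul_left, polar_self, mul_zero, add_zero]
          exact Or.inr hr
      have heq : ε = δ := by
        have : ε ∈ ({δ} : Set Ω) := hδ ▸ hε'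
        exact this
      rw [heq, hu] at hε
      have h3 := shift_injective hε
      have h4 : (polar u w / form (Φ α) w) • w = 0 := by simpa using h3.symm
      rw [hr] at h4
      have h5 := (smul_eq_zero.1 h4).resolve_right (ne_zero_of_form_eq rfl hw0)
      exact one_div_ne_zero hw0 h5
  · rintro ⟨hR', hn⟩
    obtain ⟨v, hv, hvx⟩ := hR'.1.1
    obtain ⟨w, hw, hwy⟩ := hR'.1.2
    simp only at hv hvx hw hwy
    obtain ⟨-, -, hr⟩ := (memR hv hw).1 hR'
    rcases hr with hr | hr
    · exact ⟨v, w, hv, hw, hvx, hwy, hr⟩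
    exfalso
    have hw0 : form (Φ α) w ≠ 0 := hwy.trans_ne hy'
    refine hn (Set.ncard_eq_one.2 ?_)
    have hkw : form (Φ α) (k • w) = x := by rw [form_smul, hwy, hky]
    have hkw' : polar (k • w) w = 0 := by rw [polar_smul_left, polar_self, mul_zero]
    obtain ⟨δ, hδ⟩ := h.exists_point α (v := k • w) (hkw ▸ x.2)
    refine ⟨δ, Set.eq_singleton_iff_unique_mem.2 ⟨⟨?_, ?_⟩, ?_⟩⟩
    · exact (memC hv hδ).2 ⟨hvx, hkw, Or.inl (by rw [polar_smul_right, hr, mul_one])⟩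
    · exact (memR hδ hw).2 ⟨hkw, hwy, Or.inl hkw'⟩
    · rintro ε ⟨hε1, hε2⟩
      have hε1' : (β, ε) ∈ C := hε1
      have hε2' : (ε, γ) ∈ R := hε2
      obtain ⟨u, hu, hux⟩ := hε1'.1.2
      simp only at hu hux
      obtain ⟨-, -, hc⟩ := (memC hv hu).1 hε1'
      obtain ⟨-, -, hr'⟩ := (memR hu hw).1 hε2'
      rcases hr' with hr' | hr'
      · refine h.injective ?_
        rw [hu, hδ, eq_of_polar_eq_zero (p := Φ α) (v := u) (w := k • w) (hkw.trans_ne hx')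
          (by rw [polar_smul_right, hr', mul_zero]) (hux.trans hkw.symm)]
      · exfalso
        have h0 : polar (v + u) w = 0 := by
          rw [polar_add_left, hr, hr']
          linear_combination h2
        obtain ⟨l, hl⟩ := exists_smul_eq_of_polar_eq_zero (ne_zero_of_form_eq rfl hw0) h0
        have hu' : u = v + l • w := by
          rw [← hl, ← add_assoc, add_self_plane, zero_add]
        have hvu : polar v u = l := by
          rw [hu', polar_add_right, polar_self, polar_smul_right, hr]
          ring
        have hly : l * (1 + l * y) = 0 := by
          have := hux
          rw [hu', form_add, form_smul, hvx, hwy, polar_smul_right, hr] at this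
          linear_combination this
        rw [hvu] at hc
        rcases mul_eq_zero.1 hly with e | e
        · rw [e] at hc
          rcases hc with hc | hc
          · exact hk0 hc.symm
          · exact hk1 (by linear_combination (-1 : F) * hc - h2)
        · rcases hc with hc | hc
          · refine h1 ?_
            rw [hc] at e
            have e' : k * y = 1 := by linear_combination e - h2
            linear_combination (-(y : F)) * hky + (k * y + 1) * e'
          · refine h1y ?_
            rw [hc] at e
            have e' : k * y = 1 + y := by linear_combination e - (1 + (y : F)) * h2
            linear_combination (-(y : F)) * hky + (k * y + 1 + y) * e' + y * h2

theorem IsEllipticModel.matchRel_mem_relations_of_mul_ne_one (h : IsEllipticModel G Φ) (α : Ω)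
    {x y : traceZero F} (hx : x ≠ 0) (hy : y ≠ 0) (h1 : (x : F) * y ≠ 1) :
    matchRel Φ α (x : F) (y : F) ∈ ((inv G).pointExtension α).relations := by
  by_cases hxy : x = y
  · subst hxy
    exact h.matchRel_self_mem_relations α hx
  by_cases h1y : (x : F) * y = 1 + (y : F) ^ 2
  · rw [← relStar_matchRel]
    refine CoherentConfiguration.relStar_mem_relations
      (h.matchRel_mem_relations_of_ne α hy hx (Ne.symm hxy) (mul_comm (x : F) y ▸ h1) ?_)
    intro h1x
    refine hxy (Subtype.ext (sq_injective_of_algebra ?_))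
    linear_combination h1y - h1x
  · exact h.matchRel_mem_relations_of_ne α hx hy hxy h1 h1y

theorem IsEllipticModel.matchRel_mem_relations (h : IsEllipticModel G Φ)
    (hcard : 3 < Nat.card (traceZero F)) (α : Ω) {x y : traceZero F} (hx : x ≠ 0) (hy : y ≠ 0) :
    matchRel Φ α (x : F) (y : F) ∈ ((inv G).pointExtension α).relations := by
  by_cases h1 : (x : F) * y = 1
  swap
  · exact h.matchRel_mem_relations_of_mul_ne_one α hx hy h1
  obtain ⟨u, hu⟩ : ∃ u, u ∉ ({0, x, y} : Set (traceZero F)) := by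
    by_contra! hall
    have h3 : ({0, x, y} : Set (traceZero F)).ncard ≤ 3 := by
      refine (Set.ncard_insert_le _ _).trans (Nat.succ_le_succ ?_)
      exact (Set.ncard_insert_le _ _).trans (by simp)
    rw [Set.eq_univ_of_forall hall, Set.ncard_univ] at h3
    omega
  simp only [Set.mem_insert_iff, Set.mem_singleton_iff, not_or] at hu
  obtain ⟨hu0, hux, huy⟩ := hu
  have hx' : (x : F) ≠ 0 := fun h0 => hx (Subtype.ext h0)
  have hy' : (y : F) ≠ 0 := fun h0 => hy (Subtype.ext h0)
  have hu' : (u : F) ≠ 0 := fun h0 => hu0 (Subtype.ext h0)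
  have h3 := h.matchRel_mem_relations_of_mul_ne_one α hx hu0 (fun e =>
    huy (Subtype.ext (mul_left_cancel₀ hx' (e.trans h1.symm))))
  have h4 := h.matchRel_mem_relations_of_mul_ne_one α hu0 hy (fun e =>
    hux (Subtype.ext (mul_right_cancel₀ hy' (e.trans h1.symm))))
  convert CoherentConfiguration.relComp_mem_relations h3 h4 using 1
  have hmid : ∀ {v z w : F × F}, z ≠ 0 → polar v z = 0 → polar z w = 0 → polar v w = 0 := by
    intro v z w hz hvz hzw
    obtain ⟨l, rfl⟩ := exists_smul_eq_of_polar_eq_zero hz hvz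
    rw [polar_smul_left, hzw, mul_zero]
  ext ⟨β, γ⟩
  constructor
  · rintro ⟨v, w, hv, hw, hvx, hwy, hvw⟩
    obtain ⟨δ, hδ, -⟩ := h.existsUnique_matchRel α hx hu0 (β := β) ⟨v, hv, hvx⟩
    refine ⟨δ, hδ, ?_⟩
    obtain ⟨v', z, hv', hz, -, hzu, hvz⟩ := hδ
    simp only at hv hv' hz hw
    obtain rfl : v = v' := shift_injective (hv.symm.trans hv')
    exact ⟨z, w, hz, hw, hzu, hwy,
      hmid (ne_zero_of_form_eq hvx hx') (polar_comm v z ▸ hvz) hvw⟩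
  · rintro ⟨δ, ⟨v, z, hv, hz, hvx, hzu, hvz⟩, ⟨z', w, hz', hw, -, hwy, hzw⟩⟩
    simp only at hz hz'
    obtain rfl : z = z' := shift_injective (hz.symm.trans hz')
    exact ⟨v, w, hv, hw, hvx, hwy, hmid (ne_zero_of_form_eq hzu hu') hvz hzw⟩

theorem IsEllipticModel.exists_isMatching (h : IsEllipticModel G Φ)
    (hcard : 3 < Nat.card (traceZero F)) (α : Ω) {x y : traceZero F} (hx : x ≠ 0) (hy : y ≠ 0) :
    nbr α (modelRel Φ (x : F)) ∈ ((inv G).pointExtension α).fibers ∧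
      nbr α (modelRel Φ (y : F)) ∈ ((inv G).pointExtension α).fibers ∧
      ∃ r ∈ ((inv G).pointExtension α).basisBetween
          (nbr α (modelRel Φ (x : F))) (nbr α (modelRel Φ (y : F))),
        ((inv G).pointExtension α).IsMatching r := by
  have hbx := h.modelRel_mem_basis α x
  have hby := h.modelRel_mem_basis α y
  refine ⟨nbr_mem_fibers hbx (h.exists_mem α x), nbr_mem_fibers hby (h.exists_mem α y),
    matchRel Φ α (x : F) (y : F), isMatching_of_existsUnique hbx hby (h.exists_mem α x)
      (h.matchRel_mem_relations hcard α hx hy) (matchRel_subset Φ α _ _)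
      (fun δ hδ => h.existsUnique_matchRel α hx hy hδ) fun γ hγ => ?_⟩
  have h1 := h.existsUnique_matchRel α hy hx hγ
  rw [← relStar_matchRel] at h1
  exact h1

end Matching

end Hollmann

theorem theorem3p2 {d : ℕ} (hd : 3 ≤ d) {F : Type*} [Field F] [Finite F]
    [Algebra (ZMod 2) F] (hF : Nat.card F = 2 ^ d) {Ω : Type*} [Finite Ω]
    (G : Subgroup (Equiv.Perm Ω)) (hG : Hollmann.IsHollmannGroup F G) :
    (∃ s : Hollmann.traceZero F → Set (Ω × Ω),
      Hollmann.IsHollmannLabelling (Hollmann.inv G) s) ∧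
    ∀ s : Hollmann.traceZero F → Set (Ω × Ω),
      Hollmann.IsHollmannLabelling (Hollmann.inv G) s →
      ∀ (α : Ω) (x y : Hollmann.traceZero F), x ≠ 0 → y ≠ 0 →
        Hollmann.nbr α (s x) ∈ ((Hollmann.inv G).pointExtension α).fibers ∧
        Hollmann.nbr α (s y) ∈ ((Hollmann.inv G).pointExtension α).fibers ∧
        ∃ r ∈ ((Hollmann.inv G).pointExtension α).basisBetween
            (Hollmann.nbr α (s x)) (Hollmann.nbr α (s y)),
          ((Hollmann.inv G).pointExtension α).IsMatching r := by
  have hdvd : 2 ∣ Nat.card F := hF ▸ dvd_pow_self 2 (by omega)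
  have h8 : 2 ^ 3 ≤ Nat.card F := hF ▸ Nat.pow_le_pow_right two_pos hd
  have hcard : 3 < Nat.card (Hollmann.traceZero F) := by
    have := Hollmann.two_mul_card_traceZero (F := F)
    omega
  obtain ⟨Φ, hΦ⟩ := hG.exists_isEllipticModel hdvd
  have hΩ : Nonempty Ω := by
    obtain ⟨v, hv⟩ := Algebra.trace_surjective (ZMod 2) F 1
    obtain ⟨ω, -⟩ := hΦ.surjective (1, v) (by rw [Hollmann.IsElliptic, one_mul, hv])
    exact ⟨ω⟩
  refine ⟨⟨_, hΦ.isHollmannLabelling⟩, fun s hs α x y hx hy => ?_⟩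
  have key : ∀ x : Hollmann.traceZero F, x ≠ 0 →
      ∃ x' : Hollmann.traceZero F, x' ≠ 0 ∧ s x = Hollmann.modelRel Φ (x' : F) := by
    intro x hx
    obtain ⟨x', -, hx'⟩ := hΦ.bijOn.surjOn (hs.bijOn.mapsTo (Set.mem_univ x))
    refine ⟨x', ?_, hx'.symm⟩
    rintro rfl
    refine hx (hs.bijOn.injOn (Set.mem_univ _) (Set.mem_univ _) ?_)
    rw [hs.zero, ← hx']
    exact hΦ.modelRel_zero
  obtain ⟨x', hx', ex⟩ := key x hx
  obtain ⟨y', hy', ey⟩ := key y hy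
  rw [ex, ey]
  exact hΦ.exists_isMatching hcard α hx' hy'
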